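/- Let $r\ge 0$ and $k\ge 1$ be integers and let $G$ be a finite tree with exactly $(r+2)k$ edges. Suppose that $G$ is not a star of degree $r+2$ each of whose arms is a minimal broom $\mathrm{Br}(k)$ with the center of the star as its root. Then one can remove at most $r$ edges from $G$ so that every tree of the resulting forest is sub-$k$. Here the following notions are used. Clumps. For a finite tree $T$ let $|K(T)|$ be its geometric realization, with every edge of length $1$. For $p\in|K(T)|$ the clumps of $T$ with respect to $p$ are the connected components $U$ of $|K(T)|\setminus\{p\}$; $\mathrm{Clump}(T,p)$ is the largest total length of a clump with respect to $p$ (it is $0$ if there are no clumps), and $\mathrm{Clump}(T)=\inf_{p\in|K(T)|}\mathrm{Clump}(T,p)$. When $p=o$ is a vertex, the clump $U$ is identified with the subtree of $T$ whose vertices are the vertices of $T$ lying in $\overline U$ and whose edges are the edges of $T$ with interior contained in $U$; this subtree contains $o$. Brooms. For real $l>0$ and integers $i,d\ge 0$, the broom $\mathrm{Br}(l,i,d)$ is the rooted tree obtained from a path $v_0,\dots,v_i$ by attaching a root $o$ to $v_0$ with an edge of length $l$ (weight $1/l$) and attaching $d$ vertices to $v_i$ with edges of weight $1$ (the edges of the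 path also have weight $1$); its boundary $B$ consists of these $d$ vertices, or is $\{v_i\}$ if $d=0$. Let $\lambda_1(\mathrm{Br}(l,i,d))$ be its first Steklov eigenvalue with vanishing Dirichlet data at $o$, that is the smallest $\lambda$ for which there is a nonzero real function $f$ on the vertices with $f(o)=0$, $\sum_y (f(y)-f(x))w_{xy}=0$ for each vertex $x\notin B\cup\{o\}$, and $\sum_y (f(x)-f(y))w_{xy}=\lambda f(x)$ for each $x\in B$. A minimal broom $\mathrm{Br}(k)$, $k\geq 1$ an integer, is any broom $\mathrm{Br}(1,i,d)$ with $i+d=k-1$ that has the least $\lambda_1$ among all brooms $\mathrm{Br}(1,i',d')$ with $i'+d'=k-1$; it is a rooted tree with $k$ edges. Stars. A star of degree $n$ with arms the rooted trees $T_1,\dots,T_n$ is the tree obtained by identifying the roots of $T_1,\dots,T_n$ to one vertex, its center. Sub-$k$. A tree $T$ is sub-$k$ if either (i) $\mathrm{Clump}(T)<k$, or (ii) there is a vertex $o$ of $T$ with $\mathrm{Clump}(T,o)=k$ such that at most one of the clumps of $T$ with respect to $o$ is isomorphic, as a tree rooted at $o$, to a minimal broom $\mathrm{Br}(k)$. 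-/

import Mathlib

open scoped Classical in
/-- The point of the geometric realization that corresponds to the vertex `v`. -/
noncomputable def vertexPoint {V : Type*} (v : V) : V → ℝ := Pi.single v 1

/-- The underlying space `|K(G)|` of the one-dimensional simplicial complex of `G`, realized in
`V → ℝ` by barycentric coordinates: its points are the vertices and the points of the edges. -/
def realization {V : Type*} (G : SimpleGraph V) : Set (V → ℝ) :=
  {p | (∃ v, p = vertexPoint v) ∨
    ∃ x y, G.Adj x y ∧ p ∈ segment ℝ (vertexPoint x) (vertexPoint y)}

/-- The total length of a subset `U` of `|K(G)|`, where every edge is identified with `[0, 1]`.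
Every edge gives rise to two darts (its two orientations), hence the division by `2`. -/
noncomputable def totalLength {V : Type*} (G : SimpleGraph V) (U : Set (V → ℝ)) : ℝ :=
  (∑ᶠ e : G.Dart, (MeasureTheory.volume
    {t : ℝ | t ∈ Set.Icc 0 1 ∧
      AffineMap.lineMap (vertexPoint e.fst) (vertexPoint e.snd) t ∈ U}).toReal) / 2

/-- The clumps of `G` with respect to `p`: the connected components of `|K(G)| \ {p}`. -/
def clumps {V : Type*} (G : SimpleGraph V) (p : V → ℝ) : Set (Set (V → ℝ)) :=
  {U | ∃ q ∈ realization G \ {p}, U = connectedComponentIn (realization G \ {p}) q}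

/-- The clump number of `G` with respect to `p`, that is the largest length of a clump
(`0` if there is no clump, that is if `G` has only one vertex). -/
noncomputable def clumpNumberAt {V : Type*} (G : SimpleGraph V) (p : V → ℝ) : ℝ :=
  sSup (totalLength G '' clumps G p)

/-- The clump number of `G`. -/
noncomputable def clumpNumber {V : Type*} (G : SimpleGraph V) : ℝ :=
  sInf (clumpNumberAt G '' realization G)

/-- The graph `G_U` induced by a clump `U` of `G` with respect to a vertex: its vertices are the
vertices of `G` in `U` or on the boundary of `U`, its edges are those whose interior lies in `U`. -/
def clumpGraph {V : Type*} (G : SimpleGraph V) (U : Set (V → ℝ)) : G.Subgraph where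
  verts := {v | vertexPoint v ∈ closure U}
  Adj x y := G.Adj x y ∧ openSegment ℝ (vertexPoint x) (vertexPoint y) ⊆ U
  adj_sub h := h.1
  edge_vert {x y} h := by
    have h1 : vertexPoint x ∈ segment ℝ (vertexPoint x) (vertexPoint y) :=
      left_mem_segment ℝ _ _
    exact closure_mono h.2 (segment_subset_closure_openSegment h1)
  symm := ⟨fun _ _ h => ⟨h.1.symm, by rw [openSegment_symm]; exact h.2⟩⟩

/-- `c` is a Steklov eigenvalue, with vanishing Dirichlet data on `D`, of the finite graph with
vertex set `W`, edge weights `w` (extended by zero), unit vertex measure, boundary `B` and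
Dirichlet boundary `D`. -/
def IsSteklovDirichletEigenvalue {W : Type*} [Fintype W] (w : W → W → ℝ) (B D : Set W)
    (c : ℝ) : Prop :=
  ∃ f : W → ℝ, f ≠ 0 ∧
    (∀ x, x ∉ B → x ∉ D → ∑ y, (f y - f x) * w x y = 0) ∧
    (∀ x ∈ B, ∑ y, (f x - f y) * w x y = c * f x) ∧
    ∀ x ∈ D, f x = 0

/-- The first Steklov eigenvalue with vanishing Dirichlet data on `D`. -/
noncomputable def firstSteklovDirichlet {W : Type*} [Fintype W] (w : W → W → ℝ)
    (B D : Set W) : ℝ :=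
  sInf {c | IsSteklovDirichletEigenvalue w B D c}

/-- The vertices of the broom with parameters `(l, i, d)`: `Sum.inl 0` is the root (the Dirichlet
boundary vertex), `Sum.inl 1, …, Sum.inl (i + 1)` are the vertices of the path of length `i`, and
the `Sum.inr j` are the `d` boundary vertices attached to the end of the path. -/
abbrev BroomVertex (i d : ℕ) : Type := Fin (i + 2) ⊕ Fin d

/-- The underlying tree of the broom with parameters `(l, i, d)`. -/
def broomGraph (i d : ℕ) : SimpleGraph (BroomVertex i d) :=
  SimpleGraph.fromRel fun x y =>
    match x, y with
    | Sum.inl a, Sum.inl b => (a : ℕ) + 1 = (b : ℕ)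
    | Sum.inl a, Sum.inr _ => a = Fin.last (i + 1)
    | Sum.inr _, _ => False

/-- The root of a broom. -/
def broomRoot (i d : ℕ) : BroomVertex i d := Sum.inl 0

/-- The boundary of a broom: the `d` attached vertices, or the end of the path if `d = 0`. -/
def broomBoundary (i d : ℕ) : Set (BroomVertex i d) :=
  {x | (∃ j, x = Sum.inr j) ∨ d = 0 ∧ x = Sum.inl (Fin.last (i + 1))}

open scoped Classical in
/-- The edge weights of the broom with parameters `(l, i, d)`: the edge at the root has length `l`,
that is weight `1 / l`, and all the others have weight `1`. -/
noncomputable def broomWeight (l : ℝ) (i d : ℕ) (x y : BroomVertex i d) : ℝ :=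
  if (broomGraph i d).Adj x y then
    if x = broomRoot i d ∨ y = broomRoot i d then 1 / l else 1
  else 0

/-- The first Steklov eigenvalue of the broom with parameters `(l, i, d)`, with vanishing Dirichlet
data at the root. -/
noncomputable def broomEigenvalue (l : ℝ) (i d : ℕ) : ℝ :=
  firstSteklovDirichlet (broomWeight l i d) (broomBoundary i d) {broomRoot i d}

/-- The broom with parameters `(l, i, d)` is a minimal broom with parameters `(l, n)`: it has the
least first eigenvalue among the brooms with parameters `(l, i', d')`, `i' + d' = n`. -/
def IsMinimalBroomParam (l : ℝ) (n i d : ℕ) : Prop :=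
  i + d = n ∧ ∀ i' d' : ℕ, i' + d' = n → broomEigenvalue l i d ≤ broomEigenvalue l i' d'

/-- The tree `H` with root `o` is a minimal broom of integer total length `k ≥ 1`, that is a
minimal broom with parameters `(1, k - 1)`. All edges have unit length, so this is an isomorphism
of rooted trees. -/
def IsMinimalBroom {W : Type*} (k : ℕ) (H : SimpleGraph W) (o : W) : Prop :=
  ∃ i d : ℕ, IsMinimalBroomParam 1 (k - 1) i d ∧
    ∃ φ : H ≃g broomGraph i d, φ o = broomRoot i d

/-- The subgraph `H` of `G`, rooted at its vertex `o`, is a minimal broom of total length `k`. -/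
def IsMinimalBroomAt {V : Type*} {G : SimpleGraph V} (k : ℕ) (H : G.Subgraph) (o : V) : Prop :=
  ∃ h : o ∈ H.verts, IsMinimalBroom k H.coe ⟨o, h⟩

/-- The tree `G` is sub-`k`: its clump number is less than `k`, or for some vertex `o` the clump
number with respect to `o` is `k` and at most one of the clumps with respect to `o` is a minimal
broom of total length `k` with root `o`. -/
def IsSub {V : Type*} (k : ℕ) (G : SimpleGraph V) : Prop :=
  clumpNumber G < k ∨
    ∃ o : V, clumpNumberAt G (vertexPoint o) = k ∧
      {U ∈ clumps G (vertexPoint o) | IsMinimalBroomAt k (clumpGraph G U) o}.Subsingleton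

/-- `G` is the star with center `o` and arms `T 0, …, T (n - 1)`, that is their wedge sum at `o`:
the arms cover `G`, and any two of them have exactly the vertex `o` in common. -/
def IsStar {V : Type*} (G : SimpleGraph V) (o : V) {n : ℕ} (T : Fin n → G.Subgraph) : Prop :=
  (∀ j, o ∈ (T j).verts) ∧ (⨆ j, T j) = ⊤ ∧
    ∀ i j, i ≠ j → (T i).verts ∩ (T j).verts = {o}

/-- `G` is a star of degree `n` all of whose arms are minimal brooms of total length `k`, with the
center of the star as the root. -/
def IsMinimalBroomStar {V : Type*} (G : SimpleGraph V) (n k : ℕ) : Prop :=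
  ∃ (o : V) (T : Fin n → G.Subgraph), IsStar G o T ∧ ∀ j, IsMinimalBroomAt k (T j) o

/-! Lengths become vertex counts: a clump at a vertex is a branch together with the edge to it, and
its length is the number of vertices of the branch. So `G` has `(r + 2) * k + 1` vertices, and trees
are cut by counting vertices.

The tool is `IsTree.exists_balanced`: for a threshold `c`, either some vertex has only branches with
at most `c` vertices, or some edge `vw` has more than `c` vertices on both sides while all other
branches at `v` have at most `c`.

With one vertex less there is room to spare (`cutsIntoSub_of_ncard_le`). Take `c = k - 1`: in the
first case the clump number at `v` is already below `k`. In the second the side of `v` has at least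
`k` vertices and clump number below `k`; it is cut off, and induction on `r` applies to the rest. At
`r = 0` both sides have exactly `k` vertices, and the midpoint of the edge gives a clump number
below `k`.

For `G` itself (`cutsIntoSub_univ`) take `c = k`, and let `J` be the set of branches of length `k`
at `v`, on the side of `v` in the second case. Cutting all but one of them leaves a sub-`k` tree,
since a minimal broom has length `k`. If no edge is heavy on both sides, this costs at most `r` cuts
unless `J` has `r + 2` elements. Then `G` consists of these branches alone, and as it is not the
excluded star, one branch is not a minimal broom; this one and one other may stay together. If `vw`
is heavy on both sides, the side of `v` has more than `k * max J.card 1` vertices for `max J.card 1`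
cuts, which leaves few enough vertices for the previous result.

Of minimal brooms only the number of vertices matters; the eigenvalue plays no role. -/

namespace SimpleGraph

/-! ### Sides of edges and branches at vertices in a tree. -/

variable {V : Type*} {G : SimpleGraph V}

/-- The vertices on the side of `u` when the edge between `v` and `u` is removed. -/
def side (G : SimpleGraph V) (v u : V) : Set V :=
  {x | (G.deleteEdges {s(v, u)}).Reachable u x}

theorem mem_side_self (v u : V) : u ∈ G.side v u := Reachable.refl u

theorem IsTree.notMem_side (hG : G.IsTree) {v u : V} (h : G.Adj v u) : v ∉ G.side v u := by
  intro hv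
  have := isAcyclic_iff_forall_adj_isBridge.1 hG.isAcyclic h
  rw [isBridge_iff] at this
  exact this hv.symm

/-- The only edge that leaves a side is the removed one. -/
theorem eq_of_mem_side_of_notMem {v u x y : V}
    (hxy : G.Adj x y) (hx : x ∈ G.side v u) (hy : y ∉ G.side v u) : x = u ∧ y = v := by
  by_cases he : s(x, y) = s(v, u)
  · rcases Sym2.eq_iff.1 he with ⟨rfl, rfl⟩ | ⟨rfl, rfl⟩
    · exact absurd (mem_side_self _ _) hy
    · exact ⟨rfl, rfl⟩
  · refine absurd (Reachable.trans hx (Adj.reachable ?_)) hy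
    rw [deleteEdges_adj]
    exact ⟨hxy, he⟩

theorem IsTree.compl_side (hG : G.IsTree) {v u : V} (h : G.Adj v u) :
    (G.side v u)ᶜ = G.side u v := by
  ext x
  constructor
  · intro hx
    have key : ∀ {a b : V} (p : G.Walk a b), (b ∈ G.side v u ∨ b ∈ G.side u v) →
        (a ∈ G.side v u ∨ a ∈ G.side u v) := by
      intro a b p
      induction p with
      | nil => exact id
      | @cons a c b hac p ih =>
        intro hb
        by_contra! hcon
        rcases ih hb with hc | hc
        · have := eq_of_mem_side_of_notMem hac.symm hc hcon.1
          exact hcon.2 (this.2 ▸ mem_side_self _ _)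
        · have := eq_of_mem_side_of_notMem hac.symm hc hcon.2
          exact hcon.1 (this.2 ▸ mem_side_self _ _)
    obtain ⟨p⟩ := hG.connected.preconnected x v
    exact (key p (Or.inr (mem_side_self _ _))).resolve_left hx
  · intro hx hx'
    have h1 : (G.deleteEdges {s(v, u)}).Reachable v x := by
      have : (G.deleteEdges {s(u, v)}).Reachable v x := hx
      rwa [Sym2.eq_swap] at this
    exact hG.notMem_side h (Reachable.trans hx' h1.symm)

theorem IsTree.mem_side_swap (hG : G.IsTree) {v u x : V} (h : G.Adj v u) :
    x ∈ G.side u v ↔ x ∉ G.side v u := by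
  rw [← hG.compl_side h]; rfl

/-- A connected set of vertices stays connected when it is restricted to a side of an edge. -/
theorem connected_inter_side {A : Set V} (hA : (G.induce A).Connected)
    (v : V) {u : V} (hu : u ∈ A) : (G.induce (A ∩ G.side v u)).Connected := by
  -- A walk towards `u` can leave the side only from `u` itself, so it can be stopped there.
  have key : ∀ {a b : A} (p : (G.induce A).Walk a b) (ha : a.1 ∈ G.side v u)
      (hb : b.1 = u), (G.induce (A ∩ G.side v u)).Reachable ⟨a.1, a.2, ha⟩
        ⟨u, hu, mem_side_self _ _⟩ := by
    intro a b p
    induction p with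
    | nil => rintro ha rfl; exact Reachable.refl _
    | @cons a c b hac p ih =>
      intro ha hb
      by_cases hc : c.1 ∈ G.side v u
      · refine Reachable.trans (Adj.reachable ?_) (ih hc hb)
        exact hac
      · have := (eq_of_mem_side_of_notMem (G := G) hac ha hc).1
        subst this
        exact Reachable.refl _
  have hr : ∀ x : ↥(A ∩ G.side v u), (G.induce (A ∩ G.side v u)).Reachable x
      ⟨u, hu, mem_side_self _ _⟩ := by
    rintro ⟨x, hxA, hx⟩
    obtain ⟨p⟩ := hA.preconnected ⟨x, hxA⟩ ⟨u, hu⟩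
    exact key p hx rfl
  have : Nonempty ↥(A ∩ G.side v u) := ⟨⟨u, hu, mem_side_self _ _⟩⟩
  exact ⟨fun x y => (hr x).trans (hr y).symm⟩

theorem IsTree.connected_side (hG : G.IsTree) (v u : V) :
    (G.induce (G.side v u)).Connected := by
  have hu : (G.induce Set.univ).Connected :=
    (induceUnivIso G).connected_iff.2 hG.connected
  have := connected_inter_side hu v (Set.mem_univ u)
  rwa [Set.univ_inter] at this

theorem exists_mem_side {A : Set V} (hA : (G.induce A).Connected)
    {v x : V} (hv : v ∈ A) (hx : x ∈ A) (hne : x ≠ v) :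
    ∃ u ∈ A, G.Adj v u ∧ x ∈ G.side v u := by
  have key : ∀ {a b : A} (p : (G.induce A).Walk a b), b.1 = v → a.1 ≠ v →
      ∃ u ∈ A, G.Adj v u ∧ a.1 ∈ G.side v u := by
    intro a b p
    induction p with
    | nil => intro h h'; exact absurd h h'
    | @cons a c b hac p ih =>
      intro hb ha
      by_cases hc : c.1 = v
      · exact ⟨a.1, a.2, hc ▸ (show G.Adj a.1 c.1 from hac).symm, mem_side_self _ _⟩
      · obtain ⟨u, huA, hu, hcu⟩ := ih hb hc
        refine ⟨u, huA, hu, ?_⟩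
        by_contra hau
        exact ha (eq_of_mem_side_of_notMem (G := G) hac.symm hcu hau).2
  obtain ⟨p⟩ := hA.preconnected ⟨x, hx⟩ ⟨v, hv⟩
  exact key p rfl hne

/-- The sides of two different edges at the same vertex are disjoint. -/
theorem IsTree.notMem_side_of_ne (hG : G.IsTree) {v u u' x : V} (h : G.Adj v u)
    (h' : G.Adj v u') (hne : u ≠ u') (hx : x ∈ G.side v u) : x ∉ G.side v u' := by
  intro hx'
  -- The side of `u` avoids `v`, so it stays connected when the edge `vu'` is removed. A common
  -- vertex `x` would put `u` on the side of `u'`; the edge `uv` then leaves that side, which forces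
  -- `u = u'`.
  have hle : ∀ a b : ↥(G.side v u), (G.induce (G.side v u)).Adj a b →
      (G.deleteEdges {s(v, u')}).Adj a.1 b.1 := by
    intro a b hab
    rw [deleteEdges_adj]
    refine ⟨hab, fun he => ?_⟩
    rcases Sym2.eq_iff.1 he with ⟨h1, -⟩ | ⟨-, h1⟩
    · exact hG.notMem_side h (by simpa only [h1] using a.2)
    · exact hG.notMem_side h (by simpa only [h1] using b.2)
  have hr : (G.deleteEdges {s(v, u')}).Reachable x u :=
    ((hG.connected_side v u).preconnected ⟨x, hx⟩ ⟨u, mem_side_self _ _⟩).map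
      ⟨Subtype.val, fun {a b} => hle a b⟩
  have hu : u ∈ G.side v u' := Reachable.trans hx' hr
  exact hne (eq_of_mem_side_of_notMem h.symm hu (hG.notMem_side h')).1

theorem IsTree.side_subset_side (hG : G.IsTree) {v u u' : V} (h : G.Adj v u)
    (h' : G.Adj v u') (hne : u ≠ u') : G.side v u ⊆ G.side u' v := fun _ hx =>
  (hG.mem_side_swap h').2 (hG.notMem_side_of_ne h h' hne hx)

theorem IsTree.ncard_inter_side_add [Finite V] (hG : G.IsTree) (A : Set V) {v u : V}
    (h : G.Adj v u) : (A ∩ G.side v u).ncard + (A ∩ G.side u v).ncard = A.ncard := by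
  rw [← hG.compl_side h, ← Set.ncard_union_eq, Set.inter_union_compl]
  exact Set.disjoint_left.2 fun x hx hx' => hx'.2 hx.2

/-- What is left when the sides of the edges from `v` to the vertices of `J` are removed. -/
def pruned (G : SimpleGraph V) (v : V) (J : Finset V) : Set V :=
  {x | ∀ u ∈ J, x ∉ G.side v u}

theorem IsTree.mem_pruned_self (hG : G.IsTree) {v : V} {J : Finset V}
    (hJ : ∀ u ∈ J, G.Adj v u) : v ∈ G.pruned v J := fun u hu => hG.notMem_side (hJ u hu)

theorem IsTree.mem_pruned_of_adj (hG : G.IsTree) {v w : V} {J : Finset V}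
    (hJ : ∀ u ∈ J, G.Adj v u) (hw : G.Adj v w) : w ∈ G.pruned v J ↔ w ∉ J := by
  constructor
  · exact fun h hw' => h w hw' (mem_side_self _ _)
  · intro h u hu
    exact hG.notMem_side_of_ne hw (hJ u hu) (fun e => h (e ▸ hu)) (mem_side_self _ _)

theorem IsTree.inter_pruned_inter_side (hG : G.IsTree) (A : Set V) {v w : V} {J : Finset V}
    (hJ : ∀ u ∈ J, G.Adj v u) (hw : G.Adj v w) (hwJ : w ∉ J) :
    A ∩ G.pruned v J ∩ G.side v w = A ∩ G.side v w := by
  ext x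
  refine ⟨fun h => ⟨h.1.1, h.2⟩, fun h => ⟨⟨h.1, fun u hu => ?_⟩, h.2⟩⟩
  exact hG.notMem_side_of_ne hw (hJ u hu) (fun e => hwJ (e ▸ hu)) h.2

theorem pruned_empty (v : V) : G.pruned v ∅ = Set.univ := by
  ext x; simp [pruned]

theorem IsTree.pruned_insert [DecidableEq V] (hG : G.IsTree) {v u : V} (J : Finset V)
    (h : G.Adj v u) : G.pruned v (insert u J) = G.side u v ∩ G.pruned v J := by
  ext x
  simp only [pruned, Finset.mem_insert, forall_eq_or_imp, Set.mem_ofPred_eq, Set.mem_inter_iff,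
    hG.mem_side_swap h]

theorem IsTree.connected_inter_pruned (hG : G.IsTree) {A : Set V} (hA : (G.induce A).Connected)
    {v : V} (hv : v ∈ A) (J : Finset V) (hJ : ∀ u ∈ J, G.Adj v u) :
    (G.induce (A ∩ G.pruned v J)).Connected := by
  classical
  induction J using Finset.induction_on with
  | empty => rwa [pruned_empty, Set.inter_univ]
  | insert u J hu ih =>
    have h := hJ u (Finset.mem_insert_self _ _)
    have hJ' : ∀ u ∈ J, G.Adj v u := fun w hw => hJ w (Finset.mem_insert_of_mem hw)
    rw [hG.pruned_insert J h, Set.inter_comm (G.side u v), ← Set.inter_assoc]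
    exact connected_inter_side (ih hJ') u ⟨hv, hG.mem_pruned_self hJ'⟩

theorem IsTree.ncard_inter_pruned_add [Finite V] (hG : G.IsTree) (A : Set V) {v : V}
    (J : Finset V) (hJ : ∀ u ∈ J, G.Adj v u) :
    (A ∩ G.pruned v J).ncard + ∑ u ∈ J, (A ∩ G.side v u).ncard = A.ncard := by
  classical
  induction J using Finset.induction_on with
  | empty => simp [pruned_empty]
  | insert u J hu ih =>
    have h := hJ u (Finset.mem_insert_self _ _)
    have hJ' : ∀ u ∈ J, G.Adj v u := fun w hw => hJ w (Finset.mem_insert_of_mem hw)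
    rw [hG.pruned_insert J h, Set.inter_comm (G.side u v), ← Set.inter_assoc,
      Finset.sum_insert hu, ← ih hJ', ← hG.ncard_inter_side_add (A ∩ G.pruned v J) h,
      hG.inter_pruned_inter_side A hJ' h hu]
    ring

theorem IsTree.one_add_sum_ncard_le [Finite V] (hG : G.IsTree) {A : Set V} {v : V} (hv : v ∈ A)
    (J : Finset V) (hJ : ∀ u ∈ J, G.Adj v u) :
    1 + ∑ u ∈ J, (A ∩ G.side v u).ncard ≤ A.ncard := by
  rw [← hG.ncard_inter_pruned_add A J hJ]
  have : 0 < (A ∩ G.pruned v J).ncard := (Set.ncard_pos).2 ⟨v, hv, hG.mem_pruned_self hJ⟩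
  omega

/-- Either all branches at some vertex have at most `c` vertices, or some edge has more than `c`
vertices on both sides, and the other branches at one of its ends have at most `c` vertices. -/
theorem IsTree.exists_balanced [Finite V] (hG : G.IsTree) {A : Set V}
    (hA : A.Nonempty) (c : ℕ) :
    (∃ v ∈ A, ∀ u ∈ A, G.Adj v u → (A ∩ G.side v u).ncard ≤ c) ∨
    ∃ v ∈ A, ∃ w ∈ A, G.Adj v w ∧ c < (A ∩ G.side w v).ncard ∧ c < (A ∩ G.side v w).ncard ∧
      ∀ u ∈ A, G.Adj v u → u ≠ w → (A ∩ G.side v u).ncard ≤ c := by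
  -- Among all oriented edges with a heavy side, one with the smallest heavy side is chosen.
  let P : ℕ → Prop := fun n => ∃ v ∈ A, ∃ w ∈ A, G.Adj v w ∧ c < (A ∩ G.side w v).ncard ∧
    (A ∩ G.side w v).ncard = n
  by_cases hP : ∃ n, P n
  · classical
    obtain ⟨v, hv, w, hw, h, hc, hn⟩ := Nat.find_spec hP
    have hmin : ∀ u ∈ A, G.Adj v u → u ≠ w → (A ∩ G.side v u).ncard ≤ c := by
      intro u hu huv hne
      by_contra! hcon
      -- A second heavy branch at `v` would lie in the chosen side and miss `v`, against minimality.
      have := Nat.find_min' hP ⟨u, hu, v, hv, huv.symm, hcon, rfl⟩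
      rw [← hn] at this
      refine absurd this (not_le.2 (Set.ncard_lt_ncard ?_))
      refine ⟨Set.inter_subset_inter_right _ (hG.side_subset_side huv h hne), fun hsub => ?_⟩
      exact hG.notMem_side huv (hsub ⟨hv, mem_side_self _ _⟩).2
    by_cases hvw : c < (A ∩ G.side v w).ncard
    · exact Or.inr ⟨v, hv, w, hw, h, hc, hvw, hmin⟩
    · refine Or.inl ⟨v, hv, fun u hu huv => ?_⟩
      by_cases hne : u = w
      · subst hne; omega
      · exact hmin u hu huv hne
  · obtain ⟨v, hv⟩ := hA
    refine Or.inl ⟨v, hv, fun u hu huv => ?_⟩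
    by_contra! hcon
    exact hP ⟨_, u, hu, v, hv, huv.symm, hcon, rfl⟩

end SimpleGraph

/-! ### Clumps at a vertex as regions of branches in the realization. -/

section Realization

variable {W : Type*} {T : SimpleGraph W}

theorem vertexPoint_self (v : W) : vertexPoint v v = 1 := by simp [vertexPoint]

theorem vertexPoint_of_ne {v x : W} (h : x ≠ v) : vertexPoint v x = 0 := by
  simp [vertexPoint, h]

theorem vertexPoint_nonneg (v x : W) : 0 ≤ vertexPoint v x := by
  by_cases h : x = v
  · subst h; rw [vertexPoint_self]; exact zero_le_one
  · rw [vertexPoint_of_ne h]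

theorem vertexPoint_pos {v x : W} : 0 < vertexPoint v x ↔ x = v := by
  constructor
  · intro h
    by_contra hne
    rw [vertexPoint_of_ne hne] at h
    exact lt_irrefl _ h
  · rintro rfl; rw [vertexPoint_self]; exact zero_lt_one

theorem vertexPoint_mem_realization (v : W) : vertexPoint v ∈ realization T := Or.inl ⟨v, rfl⟩

theorem segment_subset_realization {x y : W} (h : T.Adj x y) :
    segment ℝ (vertexPoint x) (vertexPoint y) ⊆ realization T :=
  fun _ hp => Or.inr ⟨x, y, h, hp⟩

theorem exists_eq_of_mem_realization {p : W → ℝ} (hp : p ∈ realization T) :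
    ∃ x y, (x = y ∨ T.Adj x y) ∧ ∃ a b : ℝ, 0 ≤ a ∧ 0 ≤ b ∧ a + b = 1 ∧
      p = a • vertexPoint x + b • vertexPoint y := by
  rcases hp with ⟨x, rfl⟩ | ⟨x, y, h, a, b, ha, hb, hab, rfl⟩
  · exact ⟨x, x, Or.inl rfl, 1, 0, zero_le_one, le_rfl, by norm_num, by simp⟩
  · exact ⟨x, y, Or.inr h, a, b, ha, hb, hab, rfl⟩

theorem pos_smul_add_smul {a b : ℝ} (ha : 0 ≤ a) (hb : 0 ≤ b) {x y z : W} :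
    0 < (a • vertexPoint x + b • vertexPoint y) z ↔ (0 < a ∧ z = x) ∨ (0 < b ∧ z = y) := by
  have hx := vertexPoint_nonneg x z
  have hy := vertexPoint_nonneg y z
  rw [← vertexPoint_pos, ← vertexPoint_pos]
  simp only [Pi.add_apply, Pi.smul_apply, smul_eq_mul]
  constructor
  · intro h
    by_contra! hcon
    have h1 : a * vertexPoint x z ≤ 0 := by
      rcases ha.eq_or_lt with rfl | ha
      · simp
      · exact mul_nonpos_of_nonneg_of_nonpos ha.le (hcon.1 ha)
    have h2 : b * vertexPoint y z ≤ 0 := by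
      rcases hb.eq_or_lt with rfl | hb
      · simp
      · exact mul_nonpos_of_nonneg_of_nonpos hb.le (hcon.2 hb)
    linarith
  · rintro (⟨h1, h2⟩ | ⟨h1, h2⟩) <;> positivity

/-- The support of a point spans a vertex or an edge. Hence open stars of distinct nonadjacent
vertices are disjoint. -/
theorem eq_or_adj_of_pos {p : W → ℝ} (hp : p ∈ realization T) {x z : W} (hx : 0 < p x)
    (hz : 0 < p z) : x = z ∨ T.Adj x z := by
  obtain ⟨x', y', h, a, b, ha, hb, hab, rfl⟩ := exists_eq_of_mem_realization hp
  rw [pos_smul_add_smul ha hb] at hx hz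
  rcases hx with ⟨-, rfl⟩ | ⟨-, rfl⟩ <;> rcases hz with ⟨-, rfl⟩ | ⟨-, rfl⟩
  · exact Or.inl rfl
  · exact h
  · exact h.imp Eq.symm SimpleGraph.Adj.symm
  · exact Or.inl rfl

theorem exists_pos_of_ne {p : W → ℝ} (hp : p ∈ realization T) {v : W}
    (hne : p ≠ vertexPoint v) : ∃ x, x ≠ v ∧ 0 < p x := by
  obtain ⟨x, y, h, a, b, ha, hb, hab, rfl⟩ := exists_eq_of_mem_realization hp
  by_contra! hcon
  have h1 := fun z hz => mt (pos_smul_add_smul ha hb (x := x) (y := y)).2 (not_lt.2 (hcon z hz))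
  apply hne
  have hx : a = 0 ∨ x = v := by
    by_contra! hh
    exact h1 x hh.2 (Or.inl ⟨lt_of_le_of_ne ha (Ne.symm hh.1), rfl⟩)
  have hy : b = 0 ∨ y = v := by
    by_contra! hh
    exact h1 y hh.2 (Or.inr ⟨lt_of_le_of_ne hb (Ne.symm hh.1), rfl⟩)
  rcases hx with rfl | rfl
  · have hb1 : b = 1 := by linarith
    rcases hy with rfl | rfl
    · norm_num at hb1
    · simp [hb1]
  · rcases hy with rfl | rfl
    · have ha1 : a = 1 := by linarith
      simp [ha1]
    · rw [← add_smul, hab, one_smul]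

theorem segment_vertexPoint_subset {p : W → ℝ} (hp : p ∈ realization T) {x : W} (hx : 0 < p x) :
    segment ℝ p (vertexPoint x) ⊆ {q ∈ realization T | 0 < q x} := by
  have key : ∀ {x y : W}, (x = y ∨ T.Adj x y) →
      segment ℝ (vertexPoint x) (vertexPoint y) ⊆ realization T := by
    rintro x y (rfl | h)
    · rw [segment_same]
      exact Set.singleton_subset_iff.2 (vertexPoint_mem_realization _)
    · exact segment_subset_realization h
  intro q hq
  constructor
  · obtain ⟨x', y', h, a, b, ha, hb, hab, rfl⟩ := exists_eq_of_mem_realization hp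
    have hpseg : a • vertexPoint x' + b • vertexPoint y' ∈
      segment ℝ (vertexPoint x') (vertexPoint y') := ⟨a, b, ha, hb, hab, rfl⟩
    refine key h ((convex_segment _ _).segment_subset hpseg ?_ hq)
    rcases (pos_smul_add_smul ha hb).1 hx with ⟨-, rfl⟩ | ⟨-, rfl⟩
    · exact left_mem_segment _ _ _
    · exact right_mem_segment _ _ _
  · obtain ⟨a, b, ha, hb, hab, rfl⟩ := hq
    simp only [Pi.add_apply, Pi.smul_apply, smul_eq_mul, vertexPoint_self, mul_one]
    rcases ha.eq_or_lt with rfl | ha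
    · linarith
    · have := mul_pos ha hx
      linarith

/-- The part of the realization spanned by the open stars of the vertices in `S`. -/
def region (T : SimpleGraph W) (S : Set W) : Set (W → ℝ) :=
  {p ∈ realization T | ∃ x ∈ S, 0 < p x}

theorem vertexPoint_mem_region {S : Set W} {x : W} : vertexPoint x ∈ region T S ↔ x ∈ S := by
  constructor
  · rintro ⟨-, y, hy, hxy⟩
    rwa [vertexPoint_pos.1 hxy] at hy
  · exact fun h => ⟨vertexPoint_mem_realization x, x, h, vertexPoint_pos.2 rfl⟩

/-- `S` is the vertex set of a component of `T` without the vertex `v`, and is joined to `v`. -/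
structure IsBranch (T : SimpleGraph W) (v : W) (S : Set W) : Prop where
  connected : (T.induce S).Connected
  notMem : v ∉ S
  closed : ∀ x ∈ S, ∀ y, T.Adj x y → y ∈ S ∨ y = v
  exists_adj : ∃ u ∈ S, T.Adj v u

/-- Every point slides along its edge to a vertex of `S`, and vertices of `S` are joined by walks in
`S`. -/
theorem isPathConnected_region {S : Set W} (hS : (T.induce S).Connected) :
    IsPathConnected (region T S) := by
  have step : ∀ p ∈ region T S, ∃ x ∈ S, JoinedIn (region T S) p (vertexPoint x) := by
    rintro p ⟨hp, x, hx, hpx⟩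
    refine ⟨x, hx, JoinedIn.of_segment_subset fun q hq => ?_⟩
    have := segment_vertexPoint_subset hp hpx hq
    exact ⟨this.1, x, hx, this.2⟩
  have adj : ∀ x ∈ S, ∀ y ∈ S, T.Adj x y →
      JoinedIn (region T S) (vertexPoint x) (vertexPoint y) := by
    intro x hx y hy h
    refine JoinedIn.of_segment_subset fun q hq => ⟨segment_subset_realization h hq, ?_⟩
    obtain ⟨a, b, ha, hb, hab, rfl⟩ := hq
    rcases ha.eq_or_lt with rfl | ha'
    · exact ⟨y, hy, (pos_smul_add_smul ha hb).2 (Or.inr ⟨by linarith, rfl⟩)⟩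
    · exact ⟨x, hx, (pos_smul_add_smul ha hb).2 (Or.inl ⟨ha', rfl⟩)⟩
  have walk : ∀ {x y : S} (p : (T.induce S).Walk x y),
      JoinedIn (region T S) (vertexPoint x.1) (vertexPoint y.1) := by
    intro x y p
    induction p with
    | nil => exact JoinedIn.refl (vertexPoint_mem_region.2 (Subtype.mem _))
    | cons h p ih => exact (adj _ (Subtype.mem _) _ (Subtype.mem _) h).trans ih
  obtain ⟨x₀⟩ := hS.nonempty
  refine ⟨vertexPoint x₀.1, vertexPoint_mem_region.2 x₀.2, fun {p} hp => ?_⟩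
  obtain ⟨x, hx, hj⟩ := step p hp
  obtain ⟨w⟩ := hS.preconnected x₀ ⟨x, hx⟩
  exact (walk w).trans hj.symm

theorem isOpen_exists_pos (S : Set W) : IsOpen {p : W → ℝ | ∃ x ∈ S, 0 < p x} := by
  have : {p : W → ℝ | ∃ x ∈ S, 0 < p x} = ⋃ x ∈ S, {p : W → ℝ | 0 < p x} := by
    ext; simp
  rw [this]
  exact isOpen_biUnion fun x _ => isOpen_lt continuous_const (continuous_apply x)

theorem IsBranch.region_subset {v : W} {S : Set W} (hS : IsBranch T v S) :
    region T S ⊆ realization T \ {vertexPoint v} := by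
  rintro p ⟨hp, x, hx, hpx⟩
  refine ⟨hp, ?_⟩
  rintro rfl
  exact hS.notMem (vertexPoint_pos.1 hpx ▸ hx)

/-- Without `v`, the realization is covered by two open sets: the open stars of the vertices in `S`
and those of the vertices outside `S ∪ {v}`. No edge joins the two kinds of vertices, so the sets
are disjoint there, and a component meeting the first stays in it. -/
theorem IsBranch.connectedComponentIn_eq {v : W} {S : Set W} (hS : IsBranch T v S)
    {q : W → ℝ} (hq : q ∈ region T S) :
    connectedComponentIn (realization T \ {vertexPoint v}) q = region T S := by
  apply Set.Subset.antisymm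
  · have hpre := isPreconnected_connectedComponentIn (x := q)
      (F := realization T \ {vertexPoint v})
    have hsub := connectedComponentIn_subset (realization T \ {vertexPoint v}) q
    rw [isPreconnected_iff_subset_of_disjoint] at hpre
    have hcov := hpre _ _ (isOpen_exists_pos S) (isOpen_exists_pos (S ∪ {v})ᶜ) ?_ ?_
    · rcases hcov with h | h
      · exact fun p hp => ⟨(hsub hp).1, h hp⟩
      · exfalso
        obtain ⟨x, hx, hqx⟩ := h (mem_connectedComponentIn (hS.region_subset hq))
        obtain ⟨hqR, y, hy, hqy⟩ := hq
        rcases eq_or_adj_of_pos hqR hqy hqx with rfl | hadj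
        · exact hx (Or.inl hy)
        · exact hx (hS.closed y hy x hadj)
    · intro p hp
      obtain ⟨x, hx, hpx⟩ := exists_pos_of_ne (hsub hp).1 (hsub hp).2
      by_cases hxS : x ∈ S
      · exact Or.inl ⟨x, hxS, hpx⟩
      · exact Or.inr ⟨x, by simp [hxS, hx], hpx⟩
    · rw [Set.eq_empty_iff_forall_notMem]
      rintro p ⟨hp, ⟨y, hy, hpy⟩, ⟨x, hx, hpx⟩⟩
      rcases eq_or_adj_of_pos (hsub hp).1 hpy hpx with rfl | hadj
      · exact hx (Or.inl hy)
      · exact hx (hS.closed y hy x hadj)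
  · exact (isPathConnected_region hS.connected).isConnected.isPreconnected.subset_connectedComponentIn
      hq hS.region_subset

theorem IsBranch.region_mem_clumps {v : W} {S : Set W} (hS : IsBranch T v S) :
    region T S ∈ clumps T (vertexPoint v) := by
  obtain ⟨u, hu, -⟩ := hS.exists_adj
  have hq : vertexPoint u ∈ region T S := vertexPoint_mem_region.2 hu
  exact ⟨_, hS.region_subset hq, (hS.connectedComponentIn_eq hq).symm⟩

/-- If the branches at `v` cover all other vertices, then they are the clumps. -/
theorem exists_isBranch_of_mem_clumps {v : W} {𝓑 : Set (Set W)}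
    (h𝓑 : ∀ S ∈ 𝓑, IsBranch T v S) (hcov : ∀ x, x ≠ v → ∃ S ∈ 𝓑, x ∈ S)
    {U : Set (W → ℝ)} (hU : U ∈ clumps T (vertexPoint v)) : ∃ S ∈ 𝓑, U = region T S := by
  obtain ⟨q, hq, rfl⟩ := hU
  obtain ⟨x, hx, hqx⟩ := exists_pos_of_ne hq.1 hq.2
  obtain ⟨S, hS, hxS⟩ := hcov x hx
  exact ⟨S, hS, (h𝓑 S hS).connectedComponentIn_eq ⟨hq.1, x, hxS, hqx⟩⟩

/-! ### The length of a clump is the number of vertices of its branch. -/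

section Length

theorem lineMap_vertexPoint (x y : W) (t : ℝ) :
    AffineMap.lineMap (vertexPoint x) (vertexPoint y) t =
      (1 - t) • vertexPoint x + t • vertexPoint y := AffineMap.lineMap_apply_module _ _ _

theorem lineMap_mem_region {S : Set W} {x y : W} (h : T.Adj x y) {t : ℝ}
    (ht : t ∈ Set.Icc (0 : ℝ) 1) :
    AffineMap.lineMap (vertexPoint x) (vertexPoint y) t ∈ region T S ↔
      (t < 1 ∧ x ∈ S) ∨ (0 < t ∧ y ∈ S) := by
  have h0 : 0 ≤ 1 - t := by linarith [ht.2]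
  rw [lineMap_vertexPoint]
  constructor
  · rintro ⟨-, z, hz, hp⟩
    rcases (pos_smul_add_smul h0 ht.1).1 hp with ⟨h1, rfl⟩ | ⟨h1, rfl⟩
    · exact Or.inl ⟨by linarith, hz⟩
    · exact Or.inr ⟨h1, hz⟩
  · intro hh
    refine ⟨segment_subset_realization h ⟨_, _, h0, ht.1, by ring, rfl⟩, ?_⟩
    rcases hh with ⟨h1, hx⟩ | ⟨h1, hy⟩
    · exact ⟨x, hx, (pos_smul_add_smul h0 ht.1).2 (Or.inl ⟨by linarith, rfl⟩)⟩
    · exact ⟨y, hy, (pos_smul_add_smul h0 ht.1).2 (Or.inr ⟨h1, rfl⟩)⟩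

/-- The parameters of the points of the edge from `x` to `y` that lie in `U`. -/
def edgePart (U : Set (W → ℝ)) (x y : W) : Set ℝ :=
  {t : ℝ | t ∈ Set.Icc 0 1 ∧ AffineMap.lineMap (vertexPoint x) (vertexPoint y) t ∈ U}

theorem edgePart_subset (U : Set (W → ℝ)) (x y : W) : edgePart U x y ⊆ Set.Icc 0 1 :=
  fun _ h => h.1

theorem volume_edgePart_ne_top (U : Set (W → ℝ)) (x y : W) :
    MeasureTheory.volume (edgePart U x y) ≠ ⊤ :=
  ((MeasureTheory.measure_mono (edgePart_subset U x y)).trans_lt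
    (by rw [Real.volume_Icc]; exact ENNReal.ofReal_lt_top)).ne

theorem toReal_volume_edgePart_le (U : Set (W → ℝ)) (x y : W) :
    (MeasureTheory.volume (edgePart U x y)).toReal ≤ 1 := by
  have := ENNReal.toReal_mono (by simp [Real.volume_Icc])
    (MeasureTheory.measure_mono (μ := MeasureTheory.volume) (edgePart_subset U x y))
  simpa [Real.volume_Icc] using this

theorem totalLength_eq_sum (U : Set (W → ℝ)) [Fintype T.Dart] : totalLength T U =
    (∑ e : T.Dart, (MeasureTheory.volume (edgePart U e.fst e.snd)).toReal) / 2 := by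
  rw [totalLength, finsum_eq_sum_of_fintype]
  rfl

theorem totalLength_nonneg (U : Set (W → ℝ)) : 0 ≤ totalLength T U :=
  div_nonneg (finsum_nonneg fun _ => ENNReal.toReal_nonneg) zero_le_two

open scoped Classical in
theorem toReal_volume_edgePart_region {S : Set W} {x y : W} (h : T.Adj x y) :
    (MeasureTheory.volume (edgePart (region T S) x y)).toReal =
      if x ∈ S ∨ y ∈ S then 1 else 0 := by
  split_ifs with hxy
  · apply le_antisymm (toReal_volume_edgePart_le _ _ _)
    have hsub : Set.Ioo (0 : ℝ) 1 ⊆ edgePart (region T S) x y := fun t ht =>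
      ⟨⟨ht.1.le, ht.2.le⟩, (lineMap_mem_region h ⟨ht.1.le, ht.2.le⟩).2
        (hxy.imp (fun hx => ⟨ht.2, hx⟩) fun hy => ⟨ht.1, hy⟩)⟩
    have := ENNReal.toReal_mono (volume_edgePart_ne_top _ _ _)
      (MeasureTheory.measure_mono (μ := MeasureTheory.volume) hsub)
    simpa [Real.volume_Ioo] using this
  · have : edgePart (region T S) x y = ∅ := by
      rw [Set.eq_empty_iff_forall_notMem]
      rintro t ⟨ht, hh⟩
      rw [lineMap_mem_region h ht] at hh
      exact hxy (hh.imp And.right And.right)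
    simp [this]

theorem IsBranch.isTree_insert (hT : T.IsTree) {v : W} {S : Set W} (hS : IsBranch T v S) :
    (T.induce (insert v S)).IsTree := by
  refine ⟨?_, hT.isAcyclic.induce _⟩
  obtain ⟨u, hu, hvu⟩ := hS.exists_adj
  have hr : ∀ x : ↥(insert v S), (T.induce (insert v S)).Reachable ⟨u, Or.inr hu⟩ x := by
    rintro ⟨x, rfl | hx⟩
    · exact SimpleGraph.Adj.reachable hvu.symm
    · exact (hS.connected.preconnected ⟨u, hu⟩ ⟨x, hx⟩).map
        (⟨fun z => ⟨z.1, Or.inr z.2⟩, fun h => h⟩ : T.induce S →g T.induce (insert v S))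
  have : Nonempty ↥(insert v S) := ⟨⟨u, Or.inr hu⟩⟩
  exact ⟨fun x y => (hr x).symm.trans (hr y)⟩

/-- In a tree, a branch is touched by as many edges as it has vertices. -/
theorem IsBranch.card_darts [Finite W] (hT : T.IsTree) {v : W} {S : Set W}
    (hS : IsBranch T v S) :
    Nat.card {e : T.Dart // e.fst ∈ S ∨ e.snd ∈ S} = 2 * S.ncard := by
  classical
  have := Fintype.ofFinite W
  -- The edges that touch `S` are the edges of the tree on `S ∪ {v}`, which has one more vertex than
  -- `S` and hence `S.ncard` edges.
  have key : {e : T.Dart // e.fst ∈ S ∨ e.snd ∈ S} ≃ (T.induce (insert v S)).Dart :=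
    { toFun := fun e =>
        ⟨⟨⟨e.1.fst, e.2.elim Or.inr fun h => (hS.closed _ h _ e.1.adj.symm).symm⟩,
          ⟨e.1.snd, e.2.elim (fun h => (hS.closed _ h _ e.1.adj).symm) Or.inr⟩⟩, e.1.adj⟩
      invFun := fun e => ⟨⟨⟨e.fst.1, e.snd.1⟩, e.adj⟩, by
        have h := (show T.Adj e.fst.1 e.snd.1 from e.adj).ne
        rcases e.fst.2 with h1 | h1
        · exact Or.inr (e.snd.2.resolve_left fun h2 => h (h1.trans h2.symm))
        · exact Or.inl h1⟩
      left_inv := fun e => rfl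
      right_inv := fun e => rfl }
  have h1 := (hS.isTree_insert hT).card_edgeFinset
  have h2 := (T.induce (insert v S)).dart_card_eq_twice_card_edges
  rw [Nat.card_congr key, Nat.card_eq_fintype_card, h2]
  have h3 : Fintype.card ↥(insert v S) = S.ncard + 1 := by
    rw [← Set.ncard_insert_of_notMem hS.notMem, ← Nat.card_eq_fintype_card]
    rfl
  omega

open scoped Classical in
theorem IsBranch.sum_darts [Fintype W] (hT : T.IsTree) {v : W} {S : Set W}
    (hS : IsBranch T v S) [Fintype T.Dart] :
    ∑ e : T.Dart, (if e.fst ∈ S ∨ e.snd ∈ S then (1 : ℝ) else 0) = 2 * S.ncard := by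
  rw [Finset.sum_boole, ← Fintype.card_subtype, ← Nat.card_eq_fintype_card, hS.card_darts hT]
  push_cast
  rfl

theorem IsBranch.totalLength_region [Finite W] (hT : T.IsTree) {v : W} {S : Set W}
    (hS : IsBranch T v S) : totalLength T (region T S) = S.ncard := by
  classical
  have := Fintype.ofFinite W
  rw [totalLength_eq_sum, Finset.sum_congr rfl fun e _ => toReal_volume_edgePart_region e.adj,
    hS.sum_darts hT]
  ring

theorem clumpNumber_le {p : W → ℝ} (hp : p ∈ realization T) :
    clumpNumber T ≤ clumpNumberAt T p := by
  refine csInf_le ⟨0, ?_⟩ ⟨p, hp, rfl⟩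
  rintro _ ⟨q, -, rfl⟩
  refine Real.sSup_nonneg ?_
  rintro _ ⟨U, -, rfl⟩
  exact totalLength_nonneg U

theorem clumpNumber_lt {p : W → ℝ} (hp : p ∈ realization T) {c d : ℝ} (hc : 0 ≤ c)
    (hcd : c < d) (h : ∀ U ∈ clumps T p, totalLength T U ≤ c) : clumpNumber T < d := by
  refine ((clumpNumber_le hp).trans (Real.sSup_le ?_ hc)).trans_lt hcd
  rintro _ ⟨U, hU, rfl⟩
  exact h U hU

end Length

/-! ### The subtree that belongs to a clump. -/

section ClumpGraph

theorem IsBranch.vertexPoint_mem_closure {v : W} {S : Set W} (hS : IsBranch T v S) {x : W} :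
    vertexPoint x ∈ closure (region T S) ↔ x ∈ insert v S := by
  constructor
  · intro hx
    by_contra hcon
    -- The coordinate at a vertex outside `S ∪ {v}` vanishes on the region, hence on its closure.
    have hsub : region T S ⊆ {q : W → ℝ | q x ≤ 0} := by
      rintro p ⟨hp, y, hy, hpy⟩
      by_contra hpx
      have hpx : 0 < p x := not_le.1 hpx
      rcases eq_or_adj_of_pos hp hpy hpx with rfl | hadj
      · exact hcon (Or.inr hy)
      · exact hcon (hS.closed y hy x hadj).symm
    have := closure_minimal hsub (isClosed_le (continuous_apply x) continuous_const) hx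
    have h1 : vertexPoint x x ≤ 0 := this
    rw [vertexPoint_self] at h1
    linarith
  · rintro (rfl | hx)
    · obtain ⟨u, hu, hvu⟩ := hS.exists_adj
      have : openSegment ℝ (vertexPoint x) (vertexPoint u) ⊆ region T S := by
        rintro p ⟨a, b, ha, hb, hab, rfl⟩
        exact ⟨segment_subset_realization hvu ⟨a, b, ha.le, hb.le, hab, rfl⟩, u, hu,
          (pos_smul_add_smul ha.le hb.le).2 (Or.inr ⟨hb, rfl⟩)⟩
      exact closure_mono this (segment_subset_closure_openSegment (left_mem_segment ℝ _ _))
    · exact subset_closure (vertexPoint_mem_region.2 hx)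

theorem IsBranch.clumpGraph_region {v : W} {S : Set W} (hS : IsBranch T v S) :
    clumpGraph T (region T S) = (⊤ : T.Subgraph).induce (insert v S) := by
  ext x y
  · exact hS.vertexPoint_mem_closure
  · simp only [clumpGraph, SimpleGraph.Subgraph.induce_adj, SimpleGraph.Subgraph.top_adj]
    constructor
    · rintro ⟨h, hsub⟩
      have : ((1 / 2 : ℝ) • vertexPoint x + (1 / 2 : ℝ) • vertexPoint y) ∈ region T S :=
        hsub ⟨1 / 2, 1 / 2, by norm_num, by norm_num, by norm_num, rfl⟩
      obtain ⟨-, z, hz, hpz⟩ := this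
      rcases (pos_smul_add_smul (by norm_num) (by norm_num)).1 hpz with ⟨-, rfl⟩ | ⟨-, rfl⟩
      · exact ⟨Or.inr hz, (hS.closed _ hz _ h).symm, h⟩
      · exact ⟨(hS.closed _ hz _ h.symm).symm, Or.inr hz, h⟩
    · rintro ⟨hx, hy, h⟩
      refine ⟨h, ?_⟩
      rintro p ⟨a, b, ha, hb, hab, rfl⟩
      refine ⟨segment_subset_realization h ⟨a, b, ha.le, hb.le, hab, rfl⟩, ?_⟩
      rcases hx with rfl | hx
      · exact ⟨y, hy.resolve_left h.ne', (pos_smul_add_smul ha.le hb.le).2 (Or.inr ⟨hb, rfl⟩)⟩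
      · exact ⟨x, hx, (pos_smul_add_smul ha.le hb.le).2 (Or.inl ⟨ha, rfl⟩)⟩

end ClumpGraph

end Realization

/-! ### Clumps with respect to the midpoint of an edge. -/

section Midpoint

variable {W : Type*} {T : SimpleGraph W}

open scoped Classical in
/-- The sum of the barycentric coordinates at the vertices in `S`. -/
noncomputable def mass [Fintype W] (S : Set W) (p : W → ℝ) : ℝ := ∑ x, if x ∈ S then p x else 0

theorem continuous_mass [Fintype W] (S : Set W) : Continuous (mass S) := by
  refine continuous_finsetSum _ fun x _ => ?_
  split_ifs
  · exact continuous_apply x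
  · exact continuous_const

theorem mass_vertexPoint [Fintype W] (S : Set W) (v : W) :
    mass S (vertexPoint v) = S.indicator 1 v := by
  classical
  rw [mass, Finset.sum_eq_single v]
  · simp [vertexPoint_self, Set.indicator_apply]
  · intro x _ hx
    simp [vertexPoint_of_ne hx]
  · simp

theorem mass_add_smul [Fintype W] (S : Set W) (a b : ℝ) (x y : W) :
    mass S (a • vertexPoint x + b • vertexPoint y) =
      a * S.indicator 1 x + b * S.indicator 1 y := by
  rw [← mass_vertexPoint, ← mass_vertexPoint, mass, mass, mass, Finset.mul_sum, Finset.mul_sum,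
    ← Finset.sum_add_distrib]
  refine Finset.sum_congr rfl fun z _ => ?_
  split_ifs <;> simp

theorem mass_compl [Fintype W] (S : Set W) {p : W → ℝ} (hp : p ∈ realization T) :
    mass Sᶜ p = 1 - mass S p := by
  obtain ⟨x, y, -, a, b, -, -, hab, rfl⟩ := exists_eq_of_mem_realization hp
  rw [mass_add_smul, mass_add_smul, ← hab, Set.indicator_compl]
  simp only [Pi.sub_apply, Pi.one_apply]
  ring

/-- Only the `2 * D.ncard` darts touching `D` contribute, each at most `1`, and the dart from `x` to
`y` at most `1 / 2`. The reverse dart is not sharpened, so after halving `1 / 4` is saved rather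
than `1 / 2`; any positive saving suffices. -/
theorem totalLength_le_of_half_lt_mass [Fintype W] (hT : T.IsTree) {x y : W} {D : Set W}
    (hD : IsBranch T y D) (hx : x ∈ D) (hxy : T.Adj x y) {U : Set (W → ℝ)}
    (hU : ∀ p ∈ U, 1 / 2 < mass D p) : totalLength T U ≤ D.ncard - 1 / 4 := by
  classical
  have hmass : ∀ {a b : W} {t : ℝ}, t ∈ edgePart U a b →
      1 / 2 < (1 - t) * D.indicator 1 a + t * D.indicator 1 b := by
    intro a b t ht
    have := hU _ ht.2
    rwa [lineMap_vertexPoint, mass_add_smul] at this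
  have hle : ∀ e : T.Dart, (MeasureTheory.volume (edgePart U e.fst e.snd)).toReal ≤
      (if e.fst ∈ D ∨ e.snd ∈ D then (1 : ℝ) else 0) -
        (if e = ⟨(x, y), hxy⟩ then (1 / 2 : ℝ) else 0) := by
    intro e
    by_cases he : e = ⟨(x, y), hxy⟩
    · subst he
      have hsub : edgePart U x y ⊆ Set.Icc 0 (1 / 2) := by
        intro t ht
        have := hmass ht
        rw [Set.indicator_of_mem hx, Set.indicator_of_notMem hD.notMem] at this
        simp only [Pi.one_apply] at this
        exact ⟨ht.1.1, by linarith⟩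
      have := ENNReal.toReal_mono (by simp [Real.volume_Icc])
        (MeasureTheory.measure_mono (μ := MeasureTheory.volume) hsub)
      rw [Real.volume_Icc, ENNReal.toReal_ofReal (by norm_num)] at this
      rw [if_pos (Or.inl hx), if_pos rfl]
      linarith
    · rw [if_neg he, sub_zero]
      split_ifs with h
      · exact toReal_volume_edgePart_le _ _ _
      · push Not at h
        have : edgePart U e.fst e.snd = ∅ := by
          rw [Set.eq_empty_iff_forall_notMem]
          intro t ht
          have := hmass ht
          rw [Set.indicator_of_notMem h.1, Set.indicator_of_notMem h.2] at this
          norm_num at this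
        simp [this]
  have hsum := Finset.sum_le_sum fun e (_ : e ∈ Finset.univ) => hle e
  rw [Finset.sum_sub_distrib, hD.sum_darts hT, Finset.sum_ite_eq' Finset.univ] at hsum
  simp only [Finset.mem_univ, if_true] at hsum
  rw [totalLength_eq_sum]
  linarith

/-- An edge with the same number of vertices on both sides bounds the clump number, by its
midpoint. -/
theorem clumpNumber_lt_of_balanced_edge [Finite W] (hT : T.IsTree) {x y : W} (hxy : T.Adj x y)
    {D : Set W} (hx : x ∈ D) (hD : IsBranch T y D) (hD' : IsBranch T x Dᶜ) {k : ℕ}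
    (hk : D.ncard ≤ k) (hk' : Dᶜ.ncard ≤ k) : clumpNumber T < k := by
  have := Fintype.ofFinite W
  set m : W → ℝ := (1 / 2 : ℝ) • vertexPoint x + (1 / 2 : ℝ) • vertexPoint y with hm
  have hmR : m ∈ realization T :=
    segment_subset_realization hxy ⟨1 / 2, 1 / 2, by norm_num, by norm_num, by norm_num, rfl⟩
  have hk1 : (1 : ℝ) ≤ k := by
    have : 0 < D.ncard := (Set.ncard_pos).2 ⟨x, hx⟩
    exact_mod_cast this.trans_le hk
  have cross : ∀ z w, T.Adj z w → z ∈ D → w ∉ D → z = x ∧ w = y := fun z w h hz hw =>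
    ⟨(hD'.closed w hw z h.symm).resolve_left fun hh => hh hz, (hD.closed z hz w h).resolve_left hw⟩
  -- The mass is `0` or `1` off the edge `xy` and affine on it, so only the midpoint has mass `1 /
  -- 2`. Each clump is therefore on one side of this value.
  have hne : ∀ p ∈ realization T \ {m}, mass D p ≠ 1 / 2 := by
    rintro p ⟨hp, hpm⟩ hmass
    obtain ⟨z, w, hzw, a, b, ha, hb, hab, rfl⟩ := exists_eq_of_mem_realization hp
    rw [mass_add_smul] at hmass
    have hzw' : z ∈ D ∧ w ∉ D ∨ z ∉ D ∧ w ∈ D := by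
      by_cases hz : z ∈ D <;> by_cases hw : w ∈ D
      · simp [hz, hw] at hmass; linarith
      · exact Or.inl ⟨hz, hw⟩
      · exact Or.inr ⟨hz, hw⟩
      · simp [hz, hw] at hmass
    rcases hzw with rfl | hzw
    · rcases hzw' with h | h
      · exact h.2 h.1
      · exact h.1 h.2
    · rcases hzw' with ⟨hz, hw⟩ | ⟨hz, hw⟩
      · obtain ⟨rfl, rfl⟩ := cross z w hzw hz hw
        simp [hz, hw] at hmass
        apply hpm
        have hb' : b = 1 / 2 := by linarith
        rw [hm, hb', hmass]
        norm_num
      · obtain ⟨rfl, rfl⟩ := cross w z hzw.symm hw hz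
        simp [hz, hw] at hmass
        apply hpm
        have ha' : a = 1 / 2 := by linarith
        rw [hm, ha', hmass, add_comm]
        norm_num
  refine clumpNumber_lt hmR (c := k - 1 / 4) (by linarith) (by linarith) ?_
  rintro U ⟨q, hq, rfl⟩
  have hsub := connectedComponentIn_subset (realization T \ {m}) q
  have hpre := isPreconnected_connectedComponentIn (x := q) (F := realization T \ {m})
  rw [isPreconnected_iff_subset_of_disjoint] at hpre
  have hk2 : (D.ncard : ℝ) ≤ k := by exact_mod_cast hk
  have hk3 : (Dᶜ.ncard : ℝ) ≤ k := by exact_mod_cast hk'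
  rcases hpre {p | 1 / 2 < mass D p} {p | mass D p < 1 / 2}
    (isOpen_lt continuous_const (continuous_mass D))
    (isOpen_lt (continuous_mass D) continuous_const)
    (fun p hp => (lt_or_gt_of_ne (hne p (hsub hp))).symm)
    (Set.eq_empty_iff_forall_notMem.2 fun p hp =>
      lt_asymm (show 1 / 2 < mass D p from hp.2.1) hp.2.2) with h | h
  · exact (totalLength_le_of_half_lt_mass hT hD hx hxy fun p hp => h hp).trans (by linarith)
  · refine (totalLength_le_of_half_lt_mass hT hD' (hD'.exists_adj.elim fun u hu => ?_) hxy.symm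
      fun p hp => ?_).trans (sub_le_sub_right hk3 _)
    · have := cross x u hu.2 hx hu.1
      exact this.2 ▸ hu.1
    · rw [mass_compl D (hsub hp).1]
      have : mass D p < 1 / 2 := h hp
      linarith

end Midpoint

/-! ### Branches and clumps of the tree induced on a connected set of vertices. -/

section Induced

open SimpleGraph

variable {V : Type*} {G : SimpleGraph V}

/-- The vertices of `A` on the side of `u`, as vertices of the induced graph. -/
def branch (G : SimpleGraph V) (A : Set V) (v u : V) : Set A := {x | x.1 ∈ G.side v u}

theorem image_branch (A : Set V) (v u : V) :
    Subtype.val '' branch G A v u = A ∩ G.side v u := by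
  ext x
  simp [branch, and_comm]

theorem ncard_branch (A : Set V) (v u : V) :
    (branch G A v u).ncard = (A ∩ G.side v u).ncard := by
  rw [← image_branch, Set.ncard_image_of_injective _ Subtype.val_injective]

theorem isBranch_branch (hG : G.IsTree) {A : Set V} (hA : (G.induce A).Connected) {v u : V}
    (hv : v ∈ A) (hu : u ∈ A) (h : G.Adj v u) :
    IsBranch (G.induce A) ⟨v, hv⟩ (branch G A v u) where
  connected := by
    have := connected_inter_side hA v hu
    refine (Iso.connected_iff (?_ : G.induce (A ∩ G.side v u) ≃g _)).1 this
    exact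
      { toFun := fun x => ⟨⟨x.1, x.2.1⟩, x.2.2⟩
        invFun := fun x => ⟨x.1.1, x.1.2, x.2⟩
        left_inv := fun _ => rfl
        right_inv := fun _ => rfl
        map_rel_iff' := Iff.rfl }
  notMem := hG.notMem_side h
  closed := fun x hx y hxy => by
    by_contra! hcon
    exact hcon.2 (Subtype.ext (eq_of_mem_side_of_notMem (G := G) hxy hx hcon.1).2)
  exists_adj := ⟨⟨u, hu⟩, mem_side_self _ _, h⟩

theorem exists_eq_region_branch (hG : G.IsTree) {A : Set V} (hA : (G.induce A).Connected) {v : V}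
    (hv : v ∈ A) {U : Set (A → ℝ)} (hU : U ∈ clumps (G.induce A) (vertexPoint ⟨v, hv⟩)) :
    ∃ u ∈ A, G.Adj v u ∧ U = region (G.induce A) (branch G A v u) := by
  obtain ⟨S, ⟨u, hu, h, rfl⟩, rfl⟩ := exists_isBranch_of_mem_clumps
    (𝓑 := {S | ∃ u ∈ A, G.Adj v u ∧ S = branch G A v u}) (v := (⟨v, hv⟩ : A))
    (by rintro _ ⟨u, hu, h, rfl⟩; exact isBranch_branch hG hA hv hu h)
    (by
      intro x hx
      obtain ⟨u, hu, h, hxu⟩ := exists_mem_side hA hv x.2 fun e => hx (Subtype.ext e)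
      exact ⟨_, ⟨u, hu, h, rfl⟩, hxu⟩) hU
  exact ⟨u, hu, h, rfl⟩

theorem isTree_induce (hG : G.IsTree) {A : Set V} (hA : (G.induce A).Connected) :
    (G.induce A).IsTree := ⟨hA, hG.isAcyclic.induce A⟩

theorem totalLength_region_branch [Finite V] (hG : G.IsTree) {A : Set V}
    (hA : (G.induce A).Connected) {v u : V} (hv : v ∈ A) (hu : u ∈ A) (h : G.Adj v u) :
    totalLength (G.induce A) (region (G.induce A) (branch G A v u)) =
      (A ∩ G.side v u).ncard := by
  rw [(isBranch_branch hG hA hv hu h).totalLength_region (isTree_induce hG hA), ncard_branch]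

theorem clumpNumber_induce_lt [Finite V] (hG : G.IsTree) {A : Set V}
    (hA : (G.induce A).Connected) {v : V} (hv : v ∈ A) {k : ℕ} (hk : 1 ≤ k)
    (hlt : ∀ u ∈ A, G.Adj v u → (A ∩ G.side v u).ncard < k) : clumpNumber (G.induce A) < k := by
  have hk' : (1 : ℝ) ≤ k := by exact_mod_cast hk
  -- Lengths of clumps at a vertex are integers, so those below `k` are at most `k - 1`.
  refine clumpNumber_lt (vertexPoint_mem_realization (⟨v, hv⟩ : A)) (c := k - 1) (by linarith)
    (by linarith) fun U hU => ?_
  obtain ⟨u, hu, h, rfl⟩ := exists_eq_region_branch hG hA hv hU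
  rw [totalLength_region_branch hG hA hv hu h]
  have : ((A ∩ G.side v u).ncard : ℝ) + 1 ≤ k := by exact_mod_cast hlt u hu h
  linarith

theorem clumpNumber_induce_lt_of_edge [Finite V] (hG : G.IsTree) {A : Set V}
    (hA : (G.induce A).Connected) {v u : V} (hv : v ∈ A) (hu : u ∈ A) (h : G.Adj v u) {k : ℕ}
    (h1 : (A ∩ G.side v u).ncard ≤ k) (h2 : (A ∩ G.side u v).ncard ≤ k) :
    clumpNumber (G.induce A) < k := by
  have hc : (branch G A v u)ᶜ = branch G A u v := by
    ext x
    exact (hG.mem_side_swap h).symm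
  refine clumpNumber_lt_of_balanced_edge (isTree_induce hG hA) (x := ⟨u, hu⟩) (y := ⟨v, hv⟩)
    (D := branch G A v u) h.symm (mem_side_self _ _) (isBranch_branch hG hA hv hu h) ?_ ?_ ?_
  · rw [hc]
    exact isBranch_branch hG hA hu hv h.symm
  · rwa [ncard_branch]
  · rwa [hc, ncard_branch]

/-- The arm of the tree induced on `A` at the vertex `v` in the direction of `u`. -/
def arm (G : SimpleGraph V) (A : Set V) (v u : V) : G.Subgraph :=
  (⊤ : G.Subgraph).induce (insert v (A ∩ G.side v u))

theorem IsMinimalBroomAt.card_verts {k : ℕ} (hk : 1 ≤ k) {H : G.Subgraph} {o : V}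
    (h : IsMinimalBroomAt k H o) : H.verts.ncard = k + 1 := by
  obtain ⟨ho, i, d, ⟨hid, -⟩, φ, -⟩ := h
  have h1 : Nat.card H.verts = Nat.card (BroomVertex i d) := Nat.card_congr φ.toEquiv
  rw [Nat.card_sum, Nat.card_fin, Nat.card_fin] at h1
  rw [← Nat.card_coe_set_eq, h1]
  omega

theorem IsMinimalBroomAt.ncard_side [Finite V] (hG : G.IsTree) {k : ℕ} (hk : 1 ≤ k) {A : Set V}
    {v u : V} (h : G.Adj v u) (hb : IsMinimalBroomAt k (arm G A v u) v) :
    (A ∩ G.side v u).ncard = k := by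
  have h1 : (insert v (A ∩ G.side v u)).ncard = k + 1 := hb.card_verts hk
  rw [Set.ncard_insert_of_notMem fun hv => hG.notMem_side h hv.2] at h1
  omega

/-- Clump graphs of a piece are subgraphs of an induced graph, whereas the arms of a star are
subgraphs of `G`; this passes from the former to the latter. -/
theorem IsMinimalBroomAt.image_val {k : ℕ} {A : Set V} {S : Set A} {o : A}
    (h : IsMinimalBroomAt k ((⊤ : (G.induce A).Subgraph).induce S) o) :
    IsMinimalBroomAt k ((⊤ : G.Subgraph).induce (Subtype.val '' S)) o.1 := by
  obtain ⟨ho, i, d, hid, φ, hφ⟩ := h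
  let ψ : ((⊤ : (G.induce A).Subgraph).induce S).coe ≃g
      ((⊤ : G.Subgraph).induce (Subtype.val '' S)).coe :=
    { toEquiv := Equiv.Set.image Subtype.val S Subtype.val_injective
      map_rel_iff' := by
        rintro ⟨a, ha⟩ ⟨b, hb⟩
        have ha : a ∈ S := ha
        have hb : b ∈ S := hb
        exact ⟨fun h => ⟨ha, hb, h.2.2⟩, fun h => ⟨⟨a, ha, rfl⟩, ⟨b, hb, rfl⟩, h.2.2⟩⟩ }
  refine ⟨⟨o, ho, rfl⟩, i, d, hid, ψ.symm.trans φ, ?_⟩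
  rw [← hφ]
  exact congrArg φ (ψ.symm_apply_apply ⟨o, ho⟩)

theorem isMinimalBroomAt_arm (hG : G.IsTree) {A : Set V} (hA : (G.induce A).Connected)
    {k : ℕ} {v u : V} (hv : v ∈ A) (hu : u ∈ A) (h : G.Adj v u)
    (hb : IsMinimalBroomAt k
      (clumpGraph (G.induce A) (region (G.induce A) (branch G A v u))) ⟨v, hv⟩) :
    IsMinimalBroomAt k (arm G A v u) v := by
  rw [(isBranch_branch hG hA hv hu h).clumpGraph_region] at hb
  have := hb.image_val
  rwa [Set.image_insert_eq, image_branch] at this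

theorem isSub_induce [Finite V] (hG : G.IsTree) {A : Set V} (hA : (G.induce A).Connected)
    {k : ℕ} {v : V} (hv : v ∈ A) (hle : ∀ u ∈ A, G.Adj v u → (A ∩ G.side v u).ncard ≤ k)
    (hex : ∃ u ∈ A, G.Adj v u ∧ (A ∩ G.side v u).ncard = k)
    (hsub : {u | u ∈ A ∧ G.Adj v u ∧ IsMinimalBroomAt k (arm G A v u) v}.Subsingleton) :
    IsSub k (G.induce A) := by
  refine Or.inr ⟨⟨v, hv⟩, ?_, ?_⟩
  · obtain ⟨u, hu, h, huk⟩ := hex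
    refine IsGreatest.csSup_eq ⟨⟨_, (isBranch_branch hG hA hv hu h).region_mem_clumps, ?_⟩, ?_⟩
    · rw [totalLength_region_branch hG hA hv hu h, huk]
    · rintro _ ⟨U, hU, rfl⟩
      obtain ⟨u', hu', h', rfl⟩ := exists_eq_region_branch hG hA hv hU
      rw [totalLength_region_branch hG hA hv hu' h']
      exact_mod_cast hle u' hu' h'
  · rintro U ⟨hU, hUb⟩ U' ⟨hU', hUb'⟩
    obtain ⟨u, hu, h, rfl⟩ := exists_eq_region_branch hG hA hv hU
    obtain ⟨u', hu', h', rfl⟩ := exists_eq_region_branch hG hA hv hU'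
    rw [hsub ⟨hu, h, isMinimalBroomAt_arm hG hA hv hu h hUb⟩
      ⟨hu', h', isMinimalBroomAt_arm hG hA hv hu' h' hUb'⟩]

end Induced

/-! ### Cutting trees into sub-`k` pieces. -/

section Cutting

open SimpleGraph

variable {V : Type*} {G : SimpleGraph V}

/-- The tree induced on `A` can be cut at `n` edges or less, such that the trees of the resulting
forest are sub-`k`. -/
def CutsIntoSub (G : SimpleGraph V) (k n : ℕ) (A : Set V) : Prop :=
  ∃ S : Finset (Sym2 V), S.card ≤ n ∧ (∀ x y, s(x, y) ∈ S → x ∈ A ∧ y ∈ A ∧ G.Adj x y) ∧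
    ∀ a ∈ A, ∃ P ⊆ A, a ∈ P ∧ (G.induce P).Connected ∧ IsSub k (G.induce P) ∧
      -- With connectedness this says that `P` is a component after the cuts, in a local form that
      -- survives gluing two parts along a cut edge.
      ∀ x ∈ P, ∀ y ∈ A, G.Adj x y → (s(x, y) ∈ S ↔ y ∉ P)

theorem CutsIntoSub.mono {k n m : ℕ} {A : Set V} (h : CutsIntoSub G k n A) (hnm : n ≤ m) :
    CutsIntoSub G k m A := by
  obtain ⟨S, hS, h⟩ := h
  exact ⟨S, hS.trans hnm, h⟩

theorem CutsIntoSub.of_isSub {k : ℕ} {A : Set V} (hA : (G.induce A).Connected)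
    (h : IsSub k (G.induce A)) : CutsIntoSub G k 0 A :=
  ⟨∅, le_rfl, by simp, fun a ha =>
    ⟨A, subset_rfl, ha, hA, h, fun x _ y hy _ => by simp [hy]⟩⟩

theorem CutsIntoSub.of_cut (hG : G.IsTree) {k n m : ℕ} {A : Set V} {v u : V} (hv : v ∈ A)
    (hu : u ∈ A) (h : G.Adj v u) (h1 : CutsIntoSub G k n (A ∩ G.side v u))
    (h2 : CutsIntoSub G k m (A ∩ G.side u v)) : CutsIntoSub G k (n + m + 1) A := by
  classical
  -- A piece on one side sees none of the cuts made on the other side, and `vu` is the only edge by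
  -- which it can leave its side. Both orientations are needed below.
  have half : ∀ {v u : V} {S₁ S₂ S : Finset (Sym2 V)}, G.Adj v u →
      (∀ x y, s(x, y) ∈ S₂ → x ∈ A ∩ G.side u v ∧ y ∈ A ∩ G.side u v ∧ G.Adj x y) →
      (∀ e, e ∈ S ↔ e = s(v, u) ∨ e ∈ S₁ ∨ e ∈ S₂) →
      ∀ P ⊆ A ∩ G.side v u,
        (∀ x ∈ P, ∀ y ∈ A ∩ G.side v u, G.Adj x y → (s(x, y) ∈ S₁ ↔ y ∉ P)) →
        ∀ x ∈ P, ∀ y ∈ A, G.Adj x y → (s(x, y) ∈ S ↔ y ∉ P) := by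
    intro v u S₁ S₂ S h hS₂ hS P hP hcut x hx y hy hxy
    rw [hS]
    by_cases hyu : y ∈ G.side v u
    · rw [← hcut x hx y ⟨hy, hyu⟩ hxy]
      refine ⟨?_, fun h => Or.inr (Or.inl h)⟩
      rintro (he | he | he)
      · rcases Sym2.eq_iff.1 he with ⟨rfl, -⟩ | ⟨-, rfl⟩
        · exact absurd (hP hx).2 (hG.notMem_side h)
        · exact absurd hyu (hG.notMem_side h)
      · exact he
      · exact absurd (hP hx).2 ((hG.mem_side_swap h).1 (hS₂ x y he).1.2)
    · obtain ⟨rfl, rfl⟩ := eq_of_mem_side_of_notMem hxy (hP hx).2 hyu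
      exact iff_of_true (Or.inl Sym2.eq_swap) fun hyP => hyu (hP hyP).2
  obtain ⟨S₁, hc₁, he₁, hS₁⟩ := h1
  obtain ⟨S₂, hc₂, he₂, hS₂⟩ := h2
  refine ⟨insert s(v, u) (S₁ ∪ S₂), ?_, ?_, ?_⟩
  · have := Finset.card_insert_le s(v, u) (S₁ ∪ S₂)
    have := Finset.card_union_le S₁ S₂
    omega
  · intro x y hxy
    rcases Finset.mem_insert.1 hxy with he | he
    · rcases Sym2.eq_iff.1 he with ⟨rfl, rfl⟩ | ⟨rfl, rfl⟩
      · exact ⟨hv, hu, h⟩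
      · exact ⟨hu, hv, h.symm⟩
    · rcases Finset.mem_union.1 he with he | he
      · exact ⟨(he₁ x y he).1.1, (he₁ x y he).2.1.1, (he₁ x y he).2.2⟩
      · exact ⟨(he₂ x y he).1.1, (he₂ x y he).2.1.1, (he₂ x y he).2.2⟩
  · intro a ha
    by_cases hau : a ∈ G.side v u
    · obtain ⟨P, hP, haP, hconn, hsub, hcut⟩ := hS₁ a ⟨ha, hau⟩
      exact ⟨P, hP.trans Set.inter_subset_left, haP, hconn, hsub,
        half h he₂ (by simp) P hP hcut⟩
    · obtain ⟨P, hP, haP, hconn, hsub, hcut⟩ := hS₂ a ⟨ha, (hG.mem_side_swap h).2 hau⟩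
      refine ⟨P, hP.trans Set.inter_subset_left, haP, hconn, hsub,
        half h.symm he₁ (fun e => ?_) P hP hcut⟩
      rw [Finset.mem_insert, Finset.mem_union, Sym2.eq_swap, or_comm (a := e ∈ S₁)]

theorem CutsIntoSub.exists_deleteEdges {k r : ℕ} (h : CutsIntoSub G k r Set.univ) :
    ∃ S : Finset (Sym2 V), (S : Set (Sym2 V)) ⊆ G.edgeSet ∧ S.card ≤ r ∧
      ∀ C : (G.deleteEdges (S : Set (Sym2 V))).ConnectedComponent,
        IsSub k C.toSimpleGraph := by
  obtain ⟨S, hc, he, hS⟩ := h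
  refine ⟨S, fun e => ?_, hc, fun C => ?_⟩
  · induction e with
    | h x y => exact fun hxy => (he x y hxy).2.2
  · obtain ⟨a, ha⟩ := C.nonempty_supp
    obtain ⟨P, -, haP, hconn, hsub, hcut⟩ := hS a (Set.mem_univ a)
    have hadj : ∀ x ∈ P, ∀ y, (G.deleteEdges (S : Set (Sym2 V))).Adj x y ↔ G.Adj x y ∧ y ∈ P := by
      intro x hx y
      rw [deleteEdges_adj]
      refine and_congr_right fun hxy => ?_
      rw [Finset.mem_coe, hcut x hx y (Set.mem_univ y) hxy, not_not]
    have hCP : C.supp = P := by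
      have hCa : (G.deleteEdges (S : Set (Sym2 V))).connectedComponentMk a = C := ha
      ext x
      rw [← hCa, ConnectedComponent.mem_supp_iff, ConnectedComponent.eq]
      constructor
      · rintro ⟨p⟩
        have : ∀ {b c : V} (p : (G.deleteEdges (S : Set (Sym2 V))).Walk b c), c ∈ P → b ∈ P := by
          intro b c p
          induction p with
          | nil => exact id
          | cons h p ih => exact fun hc => ((hadj _ (ih hc) _).1 h.symm).2
        exact this p haP
      · intro hx
        exact (hconn.preconnected ⟨x, hx⟩ ⟨a, haP⟩).map
          (⟨Subtype.val, fun {b c} hbc => (hadj _ b.2 _).2 ⟨hbc, c.2⟩⟩ :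
            G.induce P →g G.deleteEdges (S : Set (Sym2 V)))
    subst hCP
    have : C.toSimpleGraph = G.induce C.supp := by
      ext x y
      exact (hadj x.1 x.2 y.1).trans (and_iff_left y.2)
    rw [this]
    exact hsub

/-- If all branches at `v` are minimal brooms, then the tree is a star of minimal brooms. -/
theorem isMinimalBroomStar_of_branches (hG : G.IsTree) {k n : ℕ} (hn : n ≠ 0) {v : V}
    (J : Finset V) (hJ : ∀ u, u ∈ J ↔ G.Adj v u) (hcard : J.card = n)
    (hb : ∀ u, G.Adj v u → IsMinimalBroomAt k (arm G Set.univ v u) v) :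
    IsMinimalBroomStar G n k := by
  subst hcard
  let e := J.equivFin
  have hadj : ∀ j, G.Adj v (e.symm j).1 := fun j => (hJ _).1 (e.symm j).2
  have hmem : ∀ j x, x ∈ (arm G Set.univ v (e.symm j).1).verts ↔
      x = v ∨ x ∈ G.side v (e.symm j).1 := by
    intro j x
    simp [arm]
  have huniv : (G.induce Set.univ).Connected := (induceUnivIso G).connected_iff.2 hG.connected
  have hcov : ∀ x, x ≠ v → ∃ j, x ∈ G.side v (e.symm j).1 := by
    intro x hx
    obtain ⟨u, -, hu, hxu⟩ := exists_mem_side huniv (Set.mem_univ v) (Set.mem_univ x) hx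
    refine ⟨e ⟨u, (hJ u).2 hu⟩, ?_⟩
    rwa [Equiv.symm_apply_apply]
  refine ⟨v, fun j => arm G Set.univ v (e.symm j).1, ⟨fun j => (hmem j v).2 (Or.inl rfl), ?_, ?_⟩,
    fun j => hb _ (hadj j)⟩
  · have hedge : ∀ x y, G.Adj x y → x ≠ v →
        ∃ j, (arm G Set.univ v (e.symm j).1).Adj x y := by
      intro x y hxy hx
      obtain ⟨j, hj⟩ := hcov x hx
      refine ⟨j, (hmem j x).2 (Or.inr hj), (hmem j y).2 ?_, hxy⟩
      by_contra! hcon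
      exact hcon.1 (eq_of_mem_side_of_notMem hxy hj hcon.2).2
    ext x y
    · simp only [Subgraph.verts_iSup, Set.mem_iUnion, Subgraph.verts_top, Set.mem_univ, iff_true]
      by_cases hx : x = v
      -- The center is covered only if there is at least one arm.
      · exact ⟨⟨0, Nat.pos_of_ne_zero hn⟩, (hmem _ x).2 (Or.inl hx)⟩
      · obtain ⟨j, hj⟩ := hcov x hx
        exact ⟨j, (hmem j x).2 (Or.inr hj)⟩
    · rw [Subgraph.iSup_adj, Subgraph.top_adj]
      refine ⟨fun ⟨j, hj⟩ => hj.adj_sub, fun hxy => ?_⟩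
      by_cases hx : x = v
      · obtain ⟨j, hj⟩ := hedge y x hxy.symm fun hy => hxy.ne (hx.trans hy.symm)
        exact ⟨j, hj.symm⟩
      · exact hedge x y hxy hx
  · intro i j hij
    ext x
    rw [Set.mem_inter_iff, hmem, hmem, Set.mem_singleton_iff]
    refine ⟨?_, fun h => ⟨Or.inl h, Or.inl h⟩⟩
    rintro ⟨hi, hj⟩
    by_contra hx
    refine hG.notMem_side_of_ne (hadj i) (hadj j) (fun he => hij ?_) (hi.resolve_left hx)
      (hj.resolve_left hx)
    exact e.symm.injective (Subtype.ext he)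

variable [Finite V]

/-- A tree with less than `(r + 2) * k` edges can be cut into sub-`k` trees at `r` edges. -/
theorem cutsIntoSub_of_ncard_le (hG : G.IsTree) {k : ℕ} (hk : 1 ≤ k) (r : ℕ) {A : Set V}
    (hA : (G.induce A).Connected) (hcard : A.ncard ≤ (r + 2) * k) : CutsIntoSub G k r A := by
  induction r generalizing A with
  | zero =>
    refine .of_isSub hA (Or.inl ?_)
    rcases hG.exists_balanced (Set.nonempty_coe_sort.1 hA.nonempty) (k - 1) with
      ⟨v, hv, hle⟩ | ⟨v, hv, w, hw, h, h1, h2, -⟩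
    · refine clumpNumber_induce_lt hG hA hv hk fun u hu h => ?_
      have := hle u hu h
      omega
    · have := hG.ncard_inter_side_add A h
      -- Both sides have at least `k` vertices and together at most `2 * k`, so each has exactly
      -- `k`.
      exact clumpNumber_induce_lt_of_edge hG hA hv hw h (by omega) (by omega)
  | succ r ih =>
    rcases hG.exists_balanced (Set.nonempty_coe_sort.1 hA.nonempty) (k - 1) with
      ⟨v, hv, hle⟩ | ⟨v, hv, w, hw, h, h1, h2, hle⟩
    · refine (CutsIntoSub.of_isSub hA (Or.inl ?_)).mono (Nat.zero_le _)
      refine clumpNumber_induce_lt hG hA hv hk fun u hu h => ?_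
      have := hle u hu h
      omega
    · have hsum := hG.ncard_inter_side_add A h
      -- The side of `v` takes away at least `k` vertices, which pays for one cut.
      have hw' : CutsIntoSub G k r (A ∩ G.side v w) := by
        refine ih (connected_inter_side hA v hw) ?_
        have : (r + 1 + 2) * k = (r + 2) * k + k := by ring
        omega
      have hconn := connected_inter_side hA w hv
      have hv' : CutsIntoSub G k 0 (A ∩ G.side w v) := by
        refine .of_isSub hconn (Or.inl ?_)
        refine clumpNumber_induce_lt hG hconn ⟨hv, mem_side_self _ _⟩ hk fun u hu hvu => ?_
        have hne : u ≠ w := by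
          rintro rfl
          exact hG.notMem_side h.symm hu.2
        have h3 := hle u hu.1 hvu hne
        have h4 : (A ∩ G.side w v ∩ G.side v u).ncard ≤ (A ∩ G.side v u).ncard :=
          Set.ncard_le_ncard (Set.inter_subset_inter_left _ Set.inter_subset_left)
        omega
      exact (hw'.of_cut hG hv hw h hv').mono (by omega)

/-- Short branches at a vertex can be cut off one by one. -/
theorem cutsIntoSub_of_pruned (hG : G.IsTree) {k : ℕ} (hk : 1 ≤ k) {v : V} (J : Finset V)
    {A : Set V} (hA : (G.induce A).Connected) (hv : v ∈ A)
    (hJ : ∀ u ∈ J, G.Adj v u ∧ u ∈ A ∧ (A ∩ G.side v u).ncard ≤ k)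
    (hsub : IsSub k (G.induce (A ∩ G.pruned v J))) : CutsIntoSub G k J.card A := by
  classical
  induction J using Finset.induction_on generalizing A with
  | empty =>
    rw [pruned_empty, Set.inter_univ] at hsub
    exact .of_isSub hA hsub
  | insert u J hu ih =>
    obtain ⟨h, huA, hle⟩ := hJ u (Finset.mem_insert_self _ _)
    -- A branch with at most `k ≤ 2 * k` vertices needs no further cut.
    have h1 : CutsIntoSub G k 0 (A ∩ G.side v u) :=
      cutsIntoSub_of_ncard_le hG hk 0 (connected_inter_side hA v huA) (by omega)
    have h2 : CutsIntoSub G k J.card (A ∩ G.side u v) := by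
      refine ih (connected_inter_side hA u hv) ⟨hv, mem_side_self _ _⟩ (fun w hw => ?_) ?_
      · obtain ⟨hvw, hwA, hwle⟩ := hJ w (Finset.mem_insert_of_mem hw)
        have hne : w ≠ u := fun e => hu (e ▸ hw)
        refine ⟨hvw, ⟨hwA, hG.side_subset_side hvw h hne (mem_side_self _ _)⟩, ?_⟩
        exact (Set.ncard_le_ncard
          (Set.inter_subset_inter_left _ Set.inter_subset_left)).trans hwle
      · rwa [hG.pruned_insert J h, ← Set.inter_assoc] at hsub
    rw [Finset.card_insert_of_notMem hu]
    exact (h1.of_cut hG hv huA h h2).mono (by omega)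

/-- A tree with a vertex all of whose branches have length at most `k` can be cut into sub-`k`
trees at all but one of the branches of length `k`. -/
theorem cutsIntoSub_of_branches_le (hG : G.IsTree) {k : ℕ} (hk : 1 ≤ k) {v : V} (J : Finset V)
    {A : Set V} (hA : (G.induce A).Connected) (hv : v ∈ A)
    (hle : ∀ u ∈ A, G.Adj v u → (A ∩ G.side v u).ncard ≤ k)
    (hJ : ∀ u, u ∈ J ↔ u ∈ A ∧ G.Adj v u ∧ (A ∩ G.side v u).ncard = k) :
    CutsIntoSub G k (J.card - 1) A := by
  classical
  rcases J.eq_empty_or_nonempty with rfl | ⟨u₀, hu₀⟩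
  · refine .of_isSub hA (Or.inl (clumpNumber_induce_lt hG hA hv hk fun u hu h => ?_))
    have h1 := (hJ u).not.1 (Finset.notMem_empty _)
    exact lt_of_le_of_ne (hle u hu h) fun he => h1 ⟨hu, h, he⟩
  · rw [← Finset.card_erase_of_mem hu₀]
    have hJ' : ∀ u ∈ J.erase u₀, G.Adj v u := fun u hu =>
      ((hJ u).1 (Finset.mem_of_mem_erase hu)).2.1
    have hmem : ∀ {u}, G.Adj v u → u ∈ A ∩ G.pruned v (J.erase u₀) →
        A ∩ G.pruned v (J.erase u₀) ∩ G.side v u = A ∩ G.side v u := fun h hu =>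
      hG.inter_pruned_inter_side A hJ' h ((hG.mem_pruned_of_adj hJ' h).1 hu.2)
    obtain ⟨hu₀A, hvu₀, hu₀k⟩ := (hJ u₀).1 hu₀
    have hu₀P : u₀ ∈ A ∩ G.pruned v (J.erase u₀) :=
      ⟨hu₀A, (hG.mem_pruned_of_adj hJ' hvu₀).2 (Finset.notMem_erase _ _)⟩
    refine cutsIntoSub_of_pruned hG hk _ hA hv (fun u hu => ?_) ?_
    · have := (hJ u).1 (Finset.mem_of_mem_erase hu)
      exact ⟨this.2.1, this.1, this.2.2.le⟩
    · refine isSub_induce hG (hG.connected_inter_pruned hA hv _ hJ')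
        (v := v) ⟨hv, hG.mem_pruned_self hJ'⟩ (fun u hu h => ?_) ⟨u₀, hu₀P, hvu₀, ?_⟩ ?_
      · rw [hmem h hu]
        exact hle u hu.1 h
      · rw [hmem hvu₀ hu₀P, hu₀k]
      -- A minimal broom has length `k`, and `u₀` is the only branch of that length left.
      · have key : ∀ u, u ∈ A ∩ G.pruned v (J.erase u₀) ∧ G.Adj v u ∧
            IsMinimalBroomAt k (arm G (A ∩ G.pruned v (J.erase u₀)) v u) v → u = u₀ := by
          rintro u ⟨hu, h, hb⟩
          have h1 := hb.ncard_side hG hk h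
          rw [hmem h hu] at h1
          by_contra hne
          exact (hG.mem_pruned_of_adj hJ' h).1 hu.2
            (Finset.mem_erase.2 ⟨hne, (hJ u).2 ⟨hu.1, h, h1⟩⟩)
        exact fun u hu u' hu' => (key u hu).trans (key u' hu').symm

/-- A tree with exactly `r + 2` branches at a vertex, all of length `k` and one of them not a
minimal broom, can be cut into sub-`k` trees at `r` edges. -/
theorem cutsIntoSub_of_not_isMinimalBroomAt (hG : G.IsTree) {k r : ℕ} (hk : 1 ≤ k) {v u₁ : V}
    (J : Finset V) (hJ : ∀ u, u ∈ J ↔ G.Adj v u) (hcard : J.card = r + 2)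
    (hside : ∀ u ∈ J, (G.side v u).ncard = k) (hu₁ : G.Adj v u₁)
    (hb : ¬ IsMinimalBroomAt k (arm G Set.univ v u₁) v) : CutsIntoSub G k r Set.univ := by
  classical
  have huniv : (G.induce Set.univ).Connected := (induceUnivIso G).connected_iff.2 hG.connected
  have hu₁J := (hJ u₁).2 hu₁
  have hc₁ : (J.erase u₁).card = r + 1 := by rw [Finset.card_erase_of_mem hu₁J, hcard]; rfl
  obtain ⟨u₂, hu₂⟩ : (J.erase u₁).Nonempty := Finset.card_pos.1 (by omega)
  set K := (J.erase u₁).erase u₂ with hK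
  have hcK : K.card = r := by rw [hK, Finset.card_erase_of_mem hu₂, hc₁]; rfl
  have hKadj : ∀ u ∈ K, G.Adj v u := fun u hu =>
    (hJ u).1 (Finset.mem_of_mem_erase (Finset.mem_of_mem_erase hu))
  have hmem : ∀ {u}, G.Adj v u → u ∈ Set.univ ∩ G.pruned v K →
      Set.univ ∩ G.pruned v K ∩ G.side v u = Set.univ ∩ G.side v u := fun h hu =>
    hG.inter_pruned_inter_side _ hKadj h ((hG.mem_pruned_of_adj hKadj h).1 hu.2)
  have hu₁P : u₁ ∈ Set.univ ∩ G.pruned v K :=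
    ⟨Set.mem_univ _, (hG.mem_pruned_of_adj hKadj hu₁).2 fun hh =>
      Finset.notMem_erase _ _ (Finset.mem_of_mem_erase hh)⟩
  rw [← hcK]
  refine cutsIntoSub_of_pruned hG hk K huniv (Set.mem_univ v) (fun u hu => ?_) ?_
  · refine ⟨hKadj u hu, Set.mem_univ u, ?_⟩
    rw [Set.univ_inter, hside u ((hJ u).2 (hKadj u hu))]
  · refine isSub_induce hG (hG.connected_inter_pruned huniv (Set.mem_univ v) K hKadj)
      (v := v) ⟨Set.mem_univ v, hG.mem_pruned_self hKadj⟩ (fun u hu h => ?_)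
      ⟨u₁, hu₁P, hu₁, ?_⟩ ?_
    · rw [hmem h hu, Set.univ_inter, hside u ((hJ u).2 h)]
    · rw [hmem hu₁ hu₁P, Set.univ_inter, hside u₁ hu₁J]
    -- Only the branches at `u₁` and `u₂` are left, and the one at `u₁` is not a minimal broom.
    · have key : ∀ u, u ∈ Set.univ ∩ G.pruned v K ∧ G.Adj v u ∧
          IsMinimalBroomAt k (arm G (Set.univ ∩ G.pruned v K) v u) v → u = u₂ := by
        rintro u ⟨hu, h, hub⟩
        have hne : u ≠ u₁ := by
          rintro rfl
          rw [arm, hmem h hu] at hub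
          exact hb hub
        by_contra hne₂
        exact (hG.mem_pruned_of_adj hKadj h).1 hu.2
          (Finset.mem_erase.2 ⟨hne₂, Finset.mem_erase.2 ⟨hne, (hJ u).2 h⟩⟩)
      exact fun u hu u' hu' => (key u hu).trans (key u' hu').symm

theorem cutsIntoSub_univ (hG : G.IsTree) {k r : ℕ} (hk : 1 ≤ k)
    (hcard : Nat.card V = (r + 2) * k + 1) (hstar : ¬ IsMinimalBroomStar G (r + 2) k) :
    CutsIntoSub G k r Set.univ := by
  classical
  have := Fintype.ofFinite V
  have huniv : (G.induce Set.univ).Connected := (induceUnivIso G).connected_iff.2 hG.connected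
  rw [← Set.ncard_univ] at hcard
  have hsumJ : ∀ {A : Set V} {v : V} {J : Finset V}, v ∈ A →
      (∀ u ∈ J, G.Adj v u ∧ (A ∩ G.side v u).ncard = k) → 1 + J.card * k ≤ A.ncard := by
    intro A v J hv hJ
    have := hG.one_add_sum_ncard_le hv J fun u hu => (hJ u hu).1
    rwa [Finset.sum_congr rfl fun u hu => (hJ u hu).2, Finset.sum_const, smul_eq_mul] at this
  rcases hG.exists_balanced (Set.nonempty_coe_sort.1 huniv.nonempty) k with
    ⟨v, hv, hle⟩ | ⟨v, hv, w, hw, h, h1, h2, hle⟩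
  · let J : Finset V := {u | G.Adj v u ∧ (Set.univ ∩ G.side v u).ncard = k}
    have hJ : ∀ u, u ∈ J ↔ G.Adj v u ∧ (Set.univ ∩ G.side v u).ncard = k := by simp [J]
    have hJle : J.card ≤ r + 2 := by
      have := hsumJ hv fun u hu => (hJ u).1 hu
      exact Nat.le_of_mul_le_mul_right (by omega) hk
    rcases hJle.lt_or_eq with hlt | heq
    · refine (cutsIntoSub_of_branches_le hG hk J huniv hv hle fun u => ?_).mono (by omega)
      rw [hJ]
      exact (and_iff_right (Set.mem_univ u)).symm
    -- The branches in `J` and `v` already account for all `(r + 2) * k + 1` vertices, so there is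
    -- no other branch.
    · have hJ' : ∀ u, u ∈ J ↔ G.Adj v u := by
        refine fun u => ⟨fun hu => ((hJ u).1 hu).1, fun hu => ?_⟩
        by_contra huJ
        have h1 := hG.one_add_sum_ncard_le hv (insert u J)
          (Finset.forall_mem_insert _ _ _ |>.2 ⟨hu, fun x hx => ((hJ x).1 hx).1⟩)
        rw [Finset.sum_insert huJ, Finset.sum_congr rfl fun u hu => ((hJ u).1 hu).2,
          Finset.sum_const, smul_eq_mul, heq, hcard] at h1
        have h2 : 0 < (Set.univ ∩ G.side v u).ncard :=
          (Set.ncard_pos).2 ⟨u, Set.mem_univ u, mem_side_self _ _⟩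
        omega
      have hex : ∃ u, G.Adj v u ∧ ¬ IsMinimalBroomAt k (arm G Set.univ v u) v := by
        by_contra! hcon
        exact hstar (isMinimalBroomStar_of_branches hG (by omega) J hJ' heq hcon)
      obtain ⟨u₁, hu₁, hb⟩ := hex
      refine cutsIntoSub_of_not_isMinimalBroomAt hG hk J hJ' heq (fun u hu => ?_) hu₁ hb
      simpa using ((hJ u).1 hu).2
  · have hconn := connected_inter_side huniv w hv
    set A := Set.univ ∩ G.side w v with hA
    have hvA : v ∈ A := ⟨hv, mem_side_self _ _⟩
    have hleA : ∀ u ∈ A, G.Adj v u → (A ∩ G.side v u).ncard ≤ k := by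
      intro u hu hvu
      have hne : u ≠ w := by
        rintro rfl
        exact hG.notMem_side h.symm hu.2
      exact (Set.ncard_le_ncard (Set.inter_subset_inter_left _ Set.inter_subset_left)).trans
        (hle u (Set.mem_univ u) hvu hne)
    let J : Finset V := {u | u ∈ A ∧ G.Adj v u ∧ (A ∩ G.side v u).ncard = k}
    have hJ : ∀ u, u ∈ J ↔ u ∈ A ∧ G.Adj v u ∧ (A ∩ G.side v u).ncard = k := by simp [J]
    -- The maximum covers `J = ∅`: then no cut is made inside `A`, the truncated `J.card - 1` is
    -- `0`, and `A` still has more than `k` vertices because the edge is balanced. In all cases `max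
    -- J.card 1` cuts are spent on `A`, including the one at `vw`.
    have hAcard : 1 + max J.card 1 * k ≤ A.ncard := by
      rcases le_total J.card 1 with hle1 | hle1
      · rw [max_eq_right hle1]
        omega
      · rw [max_eq_left hle1]
        exact hsumJ hvA fun u hu => ((hJ u).1 hu).2
    have hsum := hG.ncard_inter_side_add Set.univ h
    rw [← hA] at hsum
    -- The side of `w` also has more than `k` vertices, which bounds what `A` can contain.
    have hjr : max J.card 1 ≤ r := by
      have : (max J.card 1 + 1) * k < (r + 2) * k := by
        rw [add_mul]
        omega
      have := Nat.lt_of_mul_lt_mul_right this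
      omega
    obtain ⟨s, hs⟩ := Nat.exists_eq_add_of_le hjr
    have hw' : CutsIntoSub G k s (Set.univ ∩ G.side v w) := by
      refine cutsIntoSub_of_ncard_le hG hk s (connected_inter_side huniv v hw) ?_
      -- The `1` in `hAcard` absorbs the extra vertex of `G`, so the side of `w` has at most `(s +
      -- 2) * k` vertices.
      have : (r + 2) * k = (s + 2) * k + max J.card 1 * k := by rw [hs]; ring
      omega
    exact (hw'.of_cut hG hv hw h (cutsIntoSub_of_branches_le hG hk J hconn hvA hleA hJ)).mono
      (by omega)

end Cutting

theorem proposition6 {V : Type*} [Finite V] (G : SimpleGraph V) (hG : G.IsTree)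
    (r k : ℕ) (hk : 1 ≤ k) (hE : G.edgeSet.ncard = (r + 2) * k)
    (hstar : ¬ IsMinimalBroomStar G (r + 2) k) :
    ∃ S : Finset (Sym2 V), (S : Set (Sym2 V)) ⊆ G.edgeSet ∧ S.card ≤ r ∧
      ∀ C : (G.deleteEdges (S : Set (Sym2 V))).ConnectedComponent,
        IsSub k C.toSimpleGraph := by
  refine (cutsIntoSub_univ hG hk ?_ hstar).exists_deleteEdges
  rw [← (SimpleGraph.isTree_iff_connected_and_card.1 hG).2, Nat.card_coe_set_eq, hE]
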